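/- (Stability.) Let $d\ge 1$, $0\le s<d$, and let $B_\delta(x)$ be the open Euclidean ball in $\mathbb R^d$. For $\delta>0$ let $\gamma_\delta(\rho)=\frac{D_0}{\delta^{d+2-s}\rho^{s}}$ for $\rho<\delta$ and $\gamma_\delta(\rho)=0$ for $\rho\ge\delta$, where $D_0$ is fixed by $\int_{B_1(0)}D_0|z|^{2-s}\,dz=d$. Let $\Omega\subset\mathbb R^d$ be a bounded domain (nonempty, open, connected), $\Omega_\delta=\{x\notin\Omega:\operatorname{dist}(x,\partial\Omega)<\delta\}$, and $\chi_h=(h\mathbb Z)^d\cap(\Omega\cup\Omega_\delta)$. *Quadrature weights.* For a set of points $X$ and a point $x$ put $N_X(x)=X\cap B_\delta(x)\setminus\{x\}$. The weights $(\omega_y)_{y\in N_X(x)}$ at $x$ are a minimizer of $\sum_{y\in N_X(x)}\frac12\omega_y^2\,\gamma_\delta(|y-x|)$ subject to $$\sum_{y\in N_X(x)}p(y-x)\gamma_\delta(|x-y|)\,\omega_y=\int_{B_\delta(x)}p(y-x)\gamma_\delta(|x-y|)\,dy$$ for all polynomials $p$ on $\mathbb R^d$ of degree at most $3$. Let $C_{pos}=C_{pos}(d,s)$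 be the largest constant such that, whenever $\delta>0$ and $0<h<C_{pos}\delta$, for $X=(h\mathbb Z)^d$ and every $x\in X$ the set $N_X(x)$ is unisolvent for polynomials of degree at most $3$ and all weights at $x$ are positive. For $x_i\in\chi_h\cap\Omega$ let $\omega_{j,i}$ be the weight of $x_j\in N_{\chi_h}(x_i)$ at $x_i$. *Discrete problem.* Let $0<r\le R<\infty$ and let $A(x,y)$ be a two-point coefficient which, for each $\delta$ considered, is symmetric with $r\le A\le R$ on $(\Omega\cup\Omega_\delta)^2$ and continuous on $\overline{(\Omega\cup\Omega_\delta)^2}$; assume that $a(x):=A(x,x)$ is in $C^\infty(\Omega)$. For functions $f$ on $\Omega$ and $u^D$ on $\Omega_\delta$ with $u^D$ bounded, a function $u_h^\delta$ on $\chi_h$ solves the discrete nonlocal diffusion problem if $$-2\sum_{x_j\in\chi_h\cap B_\delta(x_i)\setminus\{x_i\}}A(x_i,x_j)\gamma_\delta(|x_i-x_j|)\big(u_h^\delta(x_j)-u_h^\delta(x_i)\big)\omega_{j,i}=f(x_i)\quad\text{for }x_i\in\chi_h\cap\Omega,$$ and $u_h^\delta(x_i)=u^D(x_i)$ for $x_i\in\chi_h\cap\Omega_\delta$.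 *Claim.* There are constants $C>0$ and $\delta_0>0$, depending only on $d,s,\Omega,r,R,A$, such that for all $0<\delta<\delta_0$ for which $\Omega\cup\Omega_\delta$ has a $C^1$ boundary, all $0<h<C_{pos}\delta$, all such $f$ and $u^D$, and every solution $u_h^\delta$ of the discrete problem, $$\max_{x_i\in\chi_h}|u_h^\delta(x_i)|\le\sup_{\Omega_\delta}|u^D|+C\max_{x_i\in\chi_h\cap\Omega}|f(x_i)|,$$ where a maximum over the empty set is $0$. In particular $C$ is independent of $h$ and $\delta$. -/

import Mathlib

open MeasureTheory
open scoped ContDiff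

noncomputable section

namespace NonlocalMeshfree

/-- The physical space `ℝᵈ` with the Euclidean norm. -/
abbrev Space (d : ℕ) := EuclideanSpace ℝ (Fin d)

/-- The constant `D₀` fixed by the normalization `∫_{B₁(0)} γ₁(|z|) |z|² dz = d`, where
`γ₁(ρ) = D₀ / ρ ^ s` on `B₁(0)`. -/
def kernelConst (d : ℕ) (s : ℝ) : ℝ :=
  d / ∫ z in Metric.ball (0 : Space d) 1, ‖z‖ ^ 2 / ‖z‖ ^ s

/-- The radial kernel `γ_δ(ρ) = D₀ / (δ ^ (d + 2 - s) ρ ^ s)` for `ρ < δ`, and `0` otherwise. -/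
def kernel (d : ℕ) (s δ ρ : ℝ) : ℝ :=
  if ρ < δ then kernelConst d s / (δ ^ ((d : ℝ) + 2 - s) * ρ ^ s) else 0

/-- The nonlocal boundary: all points outside `Ω` at distance less than `δ` from `∂Ω`. -/
def collar {d : ℕ} (Ω : Set (Space d)) (δ : ℝ) : Set (Space d) :=
  {x | x ∉ Ω ∧ Metric.infDist x (frontier Ω) < δ}

/-- The Cartesian lattice `(hℤ)ᵈ`. -/
def lattice (d : ℕ) (h : ℝ) : Set (Space d) :=
  {x | ∃ k : Fin d → ℤ, ∀ i, x i = k i * h}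

/-- The grid `χ_h = (hℤ)ᵈ ∩ (Ω ∪ Ω_δ)`. -/
def grid {d : ℕ} (Ω : Set (Space d)) (δ h : ℝ) : Set (Space d) :=
  lattice d h ∩ (Ω ∪ collar Ω δ)

/-- The neighbours of `x` among the points of `X`: `X ∩ B_δ(x) \ {x}`. -/
def neighbors {d : ℕ} (X : Set (Space d)) (δ : ℝ) (x : Space d) : Set (Space d) :=
  (X ∩ Metric.ball x δ) \ {x}

/-- The reproducing space at `x`: all functions `y ↦ p(y - x) γ_δ(|x - y|)`, where `p` is a
polynomial of degree at most three. -/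
def reproducingSpace {d : ℕ} (s δ : ℝ) (x : Space d) : Set (Space d → ℝ) :=
  {q | ∃ p : MvPolynomial (Fin d) ℝ, p.totalDegree ≤ 3 ∧
    ∀ y, q y = MvPolynomial.eval (fun i => y i - x i) p * kernel d s δ ‖x - y‖}

/-- The weights `w` on the neighbours of `x` in `X` integrate the reproducing space exactly. -/
def IsExact {d : ℕ} (s : ℝ) (X : Set (Space d)) (δ : ℝ) (x : Space d) (w : Space d → ℝ) : Prop :=
  ∀ q ∈ reproducingSpace s δ x,
    ∑ᶠ y ∈ neighbors X δ x, q y * w y = ∫ y in Metric.ball x δ, q y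

/-- The quadratic objective `∑ w_y² W(|y - x|) / 2` with `W = γ_δ`. -/
def objective {d : ℕ} (s : ℝ) (X : Set (Space d)) (δ : ℝ) (x : Space d) (w : Space d → ℝ) : ℝ :=
  ∑ᶠ y ∈ neighbors X δ x, w y ^ 2 * kernel d s δ ‖y - x‖ / 2

/-- `w` solves the constrained quadratic program that defines the quadrature weights at `x`. -/
def IsQuadratureWeight {d : ℕ} (s : ℝ) (X : Set (Space d)) (δ : ℝ) (x : Space d)
    (w : Space d → ℝ) : Prop :=
  IsExact s X δ x w ∧ ∀ w', IsExact s X δ x w' → objective s X δ x w ≤ objective s X δ x w'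

/-- The neighbours of `x` in `X` are unisolvent for polynomials of degree at most three. -/
def IsUnisolvent {d : ℕ} (X : Set (Space d)) (δ : ℝ) (x : Space d) : Prop :=
  ∀ p : MvPolynomial (Fin d) ℝ, p.totalDegree ≤ 3 →
    (∀ y ∈ neighbors X δ x, MvPolynomial.eval (fun i => y i - x i) p = 0) → p = 0

/-- The constants `c > 0` such that `h < c δ` guarantees unisolvency and positive quadrature
weights on full lattice balls. -/
def positivityConstants (d : ℕ) (s : ℝ) : Set ℝ :=
  {c | 0 < c ∧ ∀ δ h : ℝ, 0 < δ → 0 < h → h < c * δ → ∀ x ∈ lattice d h,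
    IsUnisolvent (lattice d h) δ x ∧
    ∀ w, IsQuadratureWeight s (lattice d h) δ x w → ∀ y ∈ neighbors (lattice d h) δ x, 0 < w y}

/-- The positive-weight constants are bounded, so that their supremum is meaningful. -/
theorem bddAbove_positivityConstants (d : ℕ) (s : ℝ) :
    BddAbove (positivityConstants d s) := by
  refine ⟨1, fun c hc => ?_⟩
  by_contra! h1
  have h0 : (0 : Space d) ∈ lattice d 1 := ⟨0, fun i => by simp⟩
  have hu := (hc.2 1 1 one_pos one_pos (by linarith) 0 h0).1
  refine one_ne_zero (hu 1 (by simp) ?_)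
  rintro y ⟨⟨⟨k, hk⟩, hy⟩, hy0⟩
  refine absurd ?_ hy0
  have hn : ‖y‖ < 1 := by simpa using hy
  have : y = 0 := by
    ext i
    have h2 : |(y i : ℝ)| < (1 : ℝ) := lt_of_le_of_lt (by simpa using PiLp.norm_apply_le y i) hn
    have h4 : (y i : ℝ) = (k i : ℝ) := by rw [hk i, mul_one]
    have h3 : |k i| < 1 := by
      have h5 : |(k i : ℝ)| < (1 : ℝ) := h4 ▸ h2
      exact_mod_cast h5
    rw [hk i, Int.abs_lt_one_iff.1 h3]
    simp
  simpa using this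

/-- `C_pos`: the largest constant such that `h < C_pos δ` guarantees unisolvency and positive
quadrature weights. It depends on `d` and `s` only. -/
def posConst (d : ℕ) (s : ℝ) : ℝ := sSup (positivityConstants d s)

/-- `U` has a `C¹` boundary: near each boundary point, `U` is a strict sublevel set of a `C¹`
function with nonvanishing derivative at that point. -/
def HasC1Boundary {d : ℕ} (U : Set (Space d)) : Prop :=
  ∀ x₀ ∈ frontier U, ∃ V : Set (Space d), IsOpen V ∧ x₀ ∈ V ∧ ∃ φ : Space d → ℝ,
    ContDiff ℝ 1 φ ∧ fderiv ℝ φ x₀ ≠ 0 ∧ U ∩ V = {x ∈ V | φ x < 0}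

/-- The standing assumptions on the two-point coefficient on `Ω ∪ Ω_δ`: symmetry, the bounds
`r ≤ A ≤ R`, and continuity up to the boundary. -/
structure IsAdmissible {d : ℕ} (Ω : Set (Space d)) (δ r R : ℝ) (A : Space d → Space d → ℝ) :
    Prop where
  symm : ∀ x ∈ Ω ∪ collar Ω δ, ∀ y ∈ Ω ∪ collar Ω δ, A x y = A y x
  bounds : ∀ x ∈ Ω ∪ collar Ω δ, ∀ y ∈ Ω ∪ collar Ω δ, r ≤ A x y ∧ A x y ≤ R
  continuousOn : ContinuousOn (Function.uncurry A)
    (closure ((Ω ∪ collar Ω δ) ×ˢ (Ω ∪ collar Ω δ)))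

/-- The discrete nonlocal diffusion operator `L_h^δ` at the grid point `x`, where `w x y` is the
quadrature weight of the neighbour `y` of `x`. -/
def discreteOperator {d : ℕ} (s : ℝ) (Ω : Set (Space d)) (A : Space d → Space d → ℝ) (δ h : ℝ)
    (w : Space d → Space d → ℝ) (u : Space d → ℝ) (x : Space d) : ℝ :=
  2 * ∑ᶠ y ∈ neighbors (grid Ω δ h) δ x,
    A x y * kernel d s δ ‖x - y‖ * (u y - u x) * w x y

/-- `u` solves the discretized nonlocal diffusion problem with source `f` and boundary datum
`uD`. Only the values of `u` on the grid matter. -/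
structure IsDiscreteSolution {d : ℕ} (s : ℝ) (Ω : Set (Space d)) (A : Space d → Space d → ℝ)
    (δ h : ℝ) (w : Space d → Space d → ℝ) (f uD u : Space d → ℝ) : Prop where
  equation : ∀ x ∈ grid Ω δ h ∩ Ω, -discreteOperator s Ω A δ h w u x = f x
  boundary : ∀ x ∈ grid Ω δ h ∩ collar Ω δ, u x = uD x

end NonlocalMeshfree

end

/-! For a grid point in `Ω` the whole lattice ball lies in the grid. Stationarity of the quadratic
program makes the weights there a polynomial of degree at most three in `y - x`, and the symmetries
of the cubic lattice leave only `α + β|y - x|²`, with `α` and `β` independent of the point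
(`exists_eq_radialWeight`). The weights are thus symmetric in the two points, so the scheme is a
symmetric difference equation with positive conductances and energy methods apply.

A subsolution `v` that is nonpositive on the collar is bounded by De Giorgi–Stampacchia truncation.
Testing the equation with `(v - t)₊` controls the energy of the truncation
(`sum_mul_translationEnergy_truncation_le`). A Faber–Krahn inequality, with constant of order `l²`
on sets of at most `l ^ d` points, then shows that raising the level by order `l²` halves the length
scale of the superlevel set (`exists_card_superlevel_le`). This form of Faber–Krahn is available
only down to the range of the jumps, so the iteration stops once the superlevel set has at most half
as many points as a suitable jump set. At a maximum point at least half of those jumps land where `v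
≤ t`, and the equation there bounds `v` (`le_of_card_superlevel_le`).

Constants independent of `h` and `δ` require lower bounds on the conductances. Positivity of `α +
β|z|²` at the shortest and the longest axis jump makes it comparable to its upper bound away from
one end of the range, and exactness on constants makes that bound at least of order `h ^ d`. The
jumps so controlled suffice for Faber–Krahn: a cube of jumps if `δ / h` is large, axis jumps
otherwise (`exists_jumps_satisfiesFaberKrahn`). The theorem follows with `v = ±u - sup |u^D|`. -/

namespace NonlocalMeshfree

/-! ### Energies of translations on an abelian group -/

section TranslationEnergy

variable {Γ : Type*} [AddCommGroup Γ]

/-- The squared `ℓ²` norm of the increment of `φ` under translation by `z`. -/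
noncomputable def translationEnergy (φ : Γ → ℝ) (z : Γ) : ℝ := ∑' x, (φ (x + z) - φ x) ^ 2

theorem translationEnergy_nonneg (φ : Γ → ℝ) (z : Γ) : 0 ≤ translationEnergy φ z :=
  tsum_nonneg fun _ => sq_nonneg _

@[simp] theorem translationEnergy_zero (φ : Γ → ℝ) : translationEnergy φ 0 = 0 := by
  simp [translationEnergy]

theorem finite_support_translate {φ : Γ → ℝ} (hφ : φ.support.Finite) (z : Γ) :
    (fun x => φ (x + z)).support.Finite :=
  hφ.preimage (f := fun x => x + z) (add_left_injective z).injOn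

theorem summable_sq_increment {φ : Γ → ℝ} (hφ : φ.support.Finite) (z z' : Γ) :
    Summable fun x => (φ (x + z) - φ (x + z')) ^ 2 := by
  refine summable_of_hasFiniteSupport
    (((finite_support_translate hφ z).union (finite_support_translate hφ z')).subset ?_)
  intro x hx
  by_contra h
  simp only [Set.mem_union, Function.mem_support, not_or, not_not] at h
  simp [h.1, h.2] at hx

/-- Young's inequality for the two increments along the path through `x + a`. The parameter `k`
stays free so that the induction on longer paths can balance the two factors. -/
theorem translationEnergy_add_le {φ : Γ → ℝ} (hφ : φ.support.Finite) (a b : Γ) {k : ℝ}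
    (hk : 0 < k) : translationEnergy φ (a + b) ≤
      (1 + k) * translationEnergy φ a + (1 + k⁻¹) * translationEnergy φ b := by
  have hb : translationEnergy φ b = ∑' x, (φ (x + (a + b)) - φ (x + a)) ^ 2 := by
    rw [translationEnergy, ← (Equiv.addRight a).tsum_eq]
    simp [add_assoc]
  have hs1 : Summable fun x => (φ (x + a) - φ x) ^ 2 := by
    simpa using summable_sq_increment hφ a 0
  have hs2 := summable_sq_increment hφ (a + b) a
  have hs3 : Summable fun x => (φ (x + (a + b)) - φ x) ^ 2 := by
    simpa using summable_sq_increment hφ (a + b) 0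
  rw [hb]
  unfold translationEnergy
  rw [← tsum_mul_left, ← tsum_mul_left, ← (hs1.mul_left _).tsum_add (hs2.mul_left _)]
  refine hs3.tsum_le_tsum (fun x => ?_) ((hs1.mul_left _).add (hs2.mul_left _))
  set p := φ (x + a) - φ x
  set q := φ (x + (a + b)) - φ (x + a)
  have : φ (x + (a + b)) - φ x = p + q := by simp [p, q]
  rw [this]
  have h : 0 ≤ k⁻¹ * (k * p - q) ^ 2 := by positivity
  have h' : k⁻¹ * (k * p - q) ^ 2 = k * p ^ 2 - 2 * p * q + k⁻¹ * q ^ 2 := by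
    field_simp
    ring
  linarith [h, h', add_sq p q]

theorem translationEnergy_sum_le {φ : Γ → ℝ} (hφ : φ.support.Finite) {ι : Type*}
    (s : Finset ι) (z : ι → Γ) : translationEnergy φ (∑ i ∈ s, z i) ≤
      s.card * ∑ i ∈ s, translationEnergy φ (z i) := by
  classical
  induction s using Finset.induction_on with
  | empty => simp
  | insert a s ha ih =>
    rcases s.eq_empty_or_nonempty with rfl | hs
    · simp
    have hk : (0 : ℝ) < s.card := by exact_mod_cast hs.card_pos
    rw [Finset.sum_insert ha, Finset.sum_insert ha, Finset.card_insert_of_notMem ha]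
    -- With `k` the number of earlier terms, `1 + k` and `(1 + k⁻¹) * k` are both the new number of
    -- terms.
    refine (translationEnergy_add_le hφ _ _ hk).trans ?_
    have h1 : (1 + (s.card : ℝ)⁻¹) * translationEnergy φ (∑ i ∈ s, z i) ≤
        (1 + (s.card : ℝ)⁻¹) * (s.card * ∑ i ∈ s, translationEnergy φ (z i)) := by gcongr
    have h2 : (1 + (s.card : ℝ)⁻¹) * (s.card * ∑ i ∈ s, translationEnergy φ (z i)) =
        (s.card + 1) * ∑ i ∈ s, translationEnergy φ (z i) := by
      field_simp
    push_cast
    linarith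

/-- Expanding the square, the energy at `z` is twice the squared norm minus twice the
autocorrelation at `z`. Over distinct translations the autocorrelations add up to at most `(∑ φ)²`,
which Cauchy–Schwarz bounds by `S.card` times the squared norm; this absorbs at most half of the
main term. -/
theorem card_mul_sum_sq_le_sum_translationEnergy {φ : Γ → ℝ} (hφ : ∀ x, 0 ≤ φ x) {S Λ : Finset Γ}
    (hS : φ.support ⊆ S) (hΛ : 2 * S.card ≤ Λ.card) :
    Λ.card * ∑ x ∈ S, φ x ^ 2 ≤ ∑ z ∈ Λ, translationEnergy φ z := by
  classical
  have hfin : φ.support.Finite := S.finite_toSet.subset hS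
  have h0 : ∀ x, x ∉ S → φ x = 0 := fun x hx => by
    by_contra h
    exact hx (hS h)
  have hsq : ∑' x, φ x ^ 2 = ∑ x ∈ S, φ x ^ 2 :=
    tsum_eq_sum fun x hx => by rw [h0 x hx, sq, mul_zero]
  have key : ∀ z, translationEnergy φ z =
      2 * ∑ x ∈ S, φ x ^ 2 - 2 * ∑ x ∈ S, φ (x + z) * φ x := by
    intro z
    have s1 : Summable fun x => φ x ^ 2 :=
      summable_of_hasFiniteSupport (hfin.subset fun x hx => by
        intro h; simp [h] at hx)
    have s2 : Summable fun x => φ (x + z) ^ 2 :=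
      summable_of_hasFiniteSupport ((finite_support_translate hfin z).subset fun x hx => by
        intro h; simp [h] at hx)
    have s3 : Summable fun x => φ (x + z) * φ x :=
      summable_of_hasFiniteSupport (hfin.subset fun x hx => by
        intro h; simp [h] at hx)
    have e2 : ∑' x, φ (x + z) ^ 2 = ∑ x ∈ S, φ x ^ 2 := by
      rw [← hsq]
      exact (Equiv.addRight z).tsum_eq fun x => φ x ^ 2
    have e3 : ∑' x, φ (x + z) * φ x = ∑ x ∈ S, φ (x + z) * φ x :=
      tsum_eq_sum fun x hx => by rw [h0 x hx, mul_zero]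
    have : ∀ x, (φ (x + z) - φ x) ^ 2 = (φ (x + z) ^ 2 + φ x ^ 2) - 2 * (φ (x + z) * φ x) :=
      fun x => by ring
    simp only [translationEnergy, this]
    rw [(s2.add s1).tsum_sub (s3.mul_left 2), s2.tsum_add s1, tsum_mul_left, e2, e3, hsq]
    ring
  have hcs : (∑ x ∈ S, φ x) ^ 2 ≤ S.card * ∑ x ∈ S, φ x ^ 2 := sq_sum_le_card_mul_sum_sq
  have hcorr : ∑ z ∈ Λ, ∑ x ∈ S, φ (x + z) * φ x ≤ (∑ x ∈ S, φ x) ^ 2 := by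
    rw [Finset.sum_comm, sq, Finset.mul_sum]
    refine Finset.sum_le_sum fun x _ => ?_
    rw [← Finset.sum_mul]
    refine mul_le_mul_of_nonneg_right ?_ (hφ x)
    calc ∑ z ∈ Λ, φ (x + z) = ∑ y ∈ Λ.image (x + ·), φ y := by
          rw [Finset.sum_image fun a _ b _ h => add_left_cancel h]
      _ ≤ ∑ y ∈ Λ.image (x + ·) ∪ S, φ y :=
          Finset.sum_le_sum_of_subset_of_nonneg Finset.subset_union_left fun y _ _ => hφ y
      _ = ∑ y ∈ S, φ y :=
          (Finset.sum_subset Finset.subset_union_right fun y _ hy => h0 y hy).symm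
  simp only [key, Finset.sum_sub_distrib, ← Finset.mul_sum, Finset.sum_const, nsmul_eq_mul]
  have hΛ' : 2 * (S.card : ℝ) ≤ Λ.card := by exact_mod_cast hΛ
  have hq : 0 ≤ ∑ x ∈ S, φ x ^ 2 := Finset.sum_nonneg fun x _ => sq_nonneg _
  nlinarith [mul_le_mul_of_nonneg_right hΛ' hq]

end TranslationEnergy

/-! ### Faber–Krahn inequalities on the integer lattice -/

section FaberKrahn

/-- Hermite's identity: exactly `z % K` of the shifts `j` push the quotient up by one. It splits an
integer into `K` nearly equal integers. -/
theorem Int.sum_range_add_ediv (z : ℤ) {K : ℕ} (hK : 0 < K) :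
    ∑ j ∈ Finset.range K, (z + j) / (K : ℤ) = z := by
  have hK' : (0 : ℤ) < K := by exact_mod_cast hK
  have hr := Int.emod_nonneg z hK'.ne'
  have hr' := Int.emod_lt_of_pos z hK'
  have hz := Int.emod_add_mul_ediv z K
  have h1 : ∀ j ∈ Finset.range K, (z + j) / (K : ℤ) =
      z / K + if K - z % K ≤ (j : ℤ) then 1 else 0 := by
    intro j hj
    have hj' : (j : ℤ) < K := by exact_mod_cast Finset.mem_range.1 hj
    have : z + j = (z % K + j) + K * (z / K) := by linarith
    rw [this, Int.add_mul_ediv_left _ _ hK'.ne', add_comm]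
    congr 1
    split_ifs with h
    · rw [Int.ediv_eq_iff_of_pos hK']
      constructor <;> linarith
    · exact Int.ediv_eq_zero_of_lt (by positivity) (by linarith)
  rw [Finset.sum_congr rfl h1, Finset.sum_add_distrib, Finset.sum_ite, Finset.sum_const_zero,
    Finset.sum_const, Finset.sum_const, Finset.card_range]
  have h2 : (Finset.range K).filter (fun j : ℕ => (K : ℤ) - z % K ≤ j) =
      Finset.Ico (K - (z % K).toNat) K := by
    ext j
    simp only [Finset.mem_filter, Finset.mem_range, Finset.mem_Ico]
    omega
  rw [h2, Nat.card_Ico]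
  simp only [nsmul_eq_mul]
  have h3 : ((K - (K - (z % K).toNat) : ℕ) : ℤ) = z % K := by omega
  push_cast [h3]
  linarith

variable {d : ℕ}

/-- Faber–Krahn inequality for jumps filling the cube `[n, 2n]ᵈ`. -/
theorem sum_sq_le_sum_cube_translationEnergy {φ : (Fin d → ℤ) → ℝ} (hφ : ∀ x, 0 ≤ φ x)
    {S : Finset (Fin d → ℤ)} (hS : φ.support ⊆ S) {n K : ℕ} (hK : 0 < K)
    (hcard : 2 * S.card ≤ (K * n) ^ d) :
    (n : ℝ) ^ d * ∑ x ∈ S, φ x ^ 2 ≤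
      K ^ 2 * ∑ w ∈ Fintype.piFinset fun _ : Fin d => Finset.Icc (n : ℤ) (2 * n),
        translationEnergy φ w := by
  classical
  have hfin : φ.support.Finite := S.finite_toSet.subset hS
  have hK' : (0 : ℤ) < K := by exact_mod_cast hK
  set Λ : Finset (Fin d → ℤ) :=
    Fintype.piFinset fun _ => Finset.Ico ((K * n : ℕ) : ℤ) (2 * (K * n : ℕ)) with hΛ
  set G : Finset (Fin d → ℤ) := Fintype.piFinset fun _ => Finset.Icc (n : ℤ) (2 * n)
  have hΛc : Λ.card = (K * n) ^ d := by
    have : (2 * ((K * n : ℕ) : ℤ) - ((K * n : ℕ) : ℤ)).toNat = K * n := by omega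
    simp only [hΛ, Fintype.card_piFinset, Int.card_Ico, this, Finset.prod_const, Finset.card_univ,
      Fintype.card_fin]
  have h1 := card_mul_sum_sq_le_sum_translationEnergy hφ hS (Λ := Λ) (by rw [hΛc]; exact hcard)
  -- A long translation is cut coordinatewise into `K` nearly equal jumps, all in the cube `G`. For
  -- fixed `j` at most `K ^ d` translations share the same piece, so no jump is overused.
  let ψ : ℕ → (Fin d → ℤ) → (Fin d → ℤ) := fun j z i => (z i + j) / K
  have hψ : ∀ z, ∑ j ∈ Finset.range K, ψ j z = z := fun z => by
    ext i
    simp only [Finset.sum_apply, ψ]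
    exact Int.sum_range_add_ediv (z i) hK
  have hmaps : ∀ j ∈ Finset.range K, ∀ z ∈ Λ, ψ j z ∈ G := by
    intro j hj z hz
    have hj' : (j : ℤ) < K := by exact_mod_cast Finset.mem_range.1 hj
    simp only [hΛ, G, Fintype.mem_piFinset, Finset.mem_Icc, Finset.mem_Ico, ψ] at hz ⊢
    intro i
    obtain ⟨ha, hb⟩ := hz i
    push_cast at ha hb
    constructor
    · rw [Int.le_ediv_iff_mul_le hK']
      nlinarith
    · rw [← Int.lt_add_one_iff, Int.ediv_lt_iff_lt_mul hK']
      nlinarith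
  have hfib : ∀ j, ∀ g, (Λ.filter fun z => ψ j z = g).card ≤ K ^ d := by
    intro j g
    have hsub : (Λ.filter fun z => ψ j z = g) ⊆
        Fintype.piFinset fun i => Finset.Ico (g i * K - j) (g i * K - j + K) := by
      intro z hz
      have hz' := (Finset.mem_filter.1 hz).2
      simp only [Fintype.mem_piFinset, Finset.mem_Ico]
      intro i
      have : (z i + j) / K = g i := congrFun hz' i
      rw [Int.ediv_eq_iff_of_pos hK'] at this
      constructor <;> linarith [this.1, this.2]
    refine (Finset.card_le_card hsub).trans ?_
    simp [Fintype.card_piFinset]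
  have h2 : ∀ j ∈ Finset.range K, ∑ z ∈ Λ, translationEnergy φ (ψ j z) ≤
      (K : ℝ) ^ d * ∑ g ∈ G, translationEnergy φ g := by
    intro j hj
    rw [← Finset.sum_fiberwise_of_maps_to (hmaps j hj), Finset.mul_sum]
    refine Finset.sum_le_sum fun g _ => ?_
    rw [Finset.sum_congr rfl fun z hz => by rw [(Finset.mem_filter.1 hz).2], Finset.sum_const,
      nsmul_eq_mul]
    exact mul_le_mul_of_nonneg_right (by exact_mod_cast hfib j g) (translationEnergy_nonneg _ _)
  have h3 : ∑ z ∈ Λ, translationEnergy φ z ≤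
      (K : ℝ) ^ d * (K ^ 2 * ∑ g ∈ G, translationEnergy φ g) := by
    calc ∑ z ∈ Λ, translationEnergy φ z
        ≤ ∑ z ∈ Λ, K * ∑ j ∈ Finset.range K, translationEnergy φ (ψ j z) := by
          refine Finset.sum_le_sum fun z _ => ?_
          have := translationEnergy_sum_le hfin (Finset.range K) fun j => ψ j z
          rwa [hψ, Finset.card_range] at this
      _ = K * ∑ j ∈ Finset.range K, ∑ z ∈ Λ, translationEnergy φ (ψ j z) := by
          rw [← Finset.mul_sum, Finset.sum_comm]
      _ ≤ K * ∑ j ∈ Finset.range K, (K : ℝ) ^ d * ∑ g ∈ G, translationEnergy φ g := by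
          gcongr with j hj
          exact h2 j hj
      _ = _ := by
          rw [Finset.sum_const, Finset.card_range, nsmul_eq_mul]
          ring
  have h4 := h1.trans h3
  rw [hΛc] at h4
  push_cast at h4
  rw [mul_pow, mul_assoc] at h4
  exact le_of_mul_le_mul_left h4 (by positivity)

/-- Faber–Krahn inequality for jumps along the coordinate axes. -/
theorem sum_sq_le_sum_axis_translationEnergy {φ : (Fin d → ℤ) → ℝ} (hφ : ∀ x, 0 ≤ φ x)
    {S : Finset (Fin d → ℤ)} (hS : φ.support ⊆ S) {K : ℕ} (hK : 0 < K) {g : ℤ} (hg : g ≠ 0)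
    (hcard : 2 * S.card ≤ K ^ d) :
    ∑ x ∈ S, φ x ^ 2 ≤ d * K ^ 2 * ∑ i : Fin d, translationEnergy φ (Pi.single i g) := by
  classical
  have hfin : φ.support.Finite := S.finite_toSet.subset hS
  set Λ : Finset (Fin d → ℤ) :=
    (Fintype.piFinset fun _ => Finset.range K).image fun a i => (a i : ℤ) * g with hΛ
  have hΛc : Λ.card = K ^ d := by
    rw [hΛ, Finset.card_image_of_injective, Fintype.card_piFinset]
    · simp
    · intro a b hab
      ext i
      have := congrFun hab i
      simpa [hg] using this
  have h1 := card_mul_sum_sq_le_sum_translationEnergy hφ hS (Λ := Λ) (by rw [hΛc]; exact hcard)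
  -- Each translation is reached by a staircase path of fewer than `K` axis jumps in every
  -- direction.
  have h2 : ∀ z ∈ Λ, translationEnergy φ z ≤
      d * K ^ 2 * ∑ i : Fin d, translationEnergy φ (Pi.single i g) := by
    intro z hz
    obtain ⟨a, ha, rfl⟩ := Finset.mem_image.1 hz
    have e : (fun i => (a i : ℤ) * g) = ∑ i, ∑ _j ∈ Finset.range (a i), Pi.single i g := by
      ext i
      simp [Finset.sum_apply, Pi.single_apply]
    rw [e]
    refine (translationEnergy_sum_le hfin _ _).trans ?_
    rw [Finset.card_univ, Fintype.card_fin, mul_assoc]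
    gcongr
    rw [Finset.mul_sum]
    refine Finset.sum_le_sum fun i _ => ?_
    refine (translationEnergy_sum_le hfin _ _).trans ?_
    rw [Finset.card_range, Finset.sum_const, Finset.card_range, nsmul_eq_mul, ← mul_assoc, ← sq]
    have : a i ≤ K := (Finset.mem_range.1 (Fintype.mem_piFinset.1 ha i)).le
    have := translationEnergy_nonneg φ (Pi.single i g)
    gcongr
  have h3 := h1.trans (Finset.sum_le_sum h2)
  rw [Finset.sum_const, nsmul_eq_mul] at h3
  refine le_of_mul_le_mul_left h3 ?_
  rw [hΛc]
  positivity

end FaberKrahn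

end NonlocalMeshfree

namespace NonlocalMeshfree

/-! ### Stampacchia truncation for symmetric difference equations -/

section Truncation

variable {Γ : Type*}

open Classical in
/-- The positive part of `v - t`, restricted to `P`. -/
noncomputable def truncation (P : Finset Γ) (v : Γ → ℝ) (t : ℝ) (x : Γ) : ℝ :=
  if x ∈ P then max (v x - t) 0 else 0

open Classical in
/-- The part of `P` on which `v` exceeds `t`. -/
noncomputable def superlevel (P : Finset Γ) (v : Γ → ℝ) (t : ℝ) : Finset Γ :=
  P.filter fun x => t < v x

theorem mem_superlevel {P : Finset Γ} {v : Γ → ℝ} {t : ℝ} {x : Γ} :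
    x ∈ superlevel P v t ↔ x ∈ P ∧ t < v x := by
  simp [superlevel]

theorem truncation_nonneg (P : Finset Γ) (v : Γ → ℝ) (t : ℝ) (x : Γ) :
    0 ≤ truncation P v t x := by
  unfold truncation
  split_ifs <;> simp

theorem support_truncation_subset (P : Finset Γ) (v : Γ → ℝ) (t : ℝ) :
    (truncation P v t).support ⊆ superlevel P v t := by
  intro x hx
  rw [Function.mem_support, truncation] at hx
  split_ifs at hx with h
  · refine Finset.mem_coe.2 (mem_superlevel.2 ⟨h, ?_⟩)
    by_contra! h'
    exact hx (max_eq_right (by linarith))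
  · exact absurd rfl hx

/-- One step of the Stampacchia iteration: a Faber–Krahn inequality with constant `b` bounds the
measure of higher superlevel sets. -/
theorem mul_card_superlevel_le {P : Finset Γ} {v : Γ → ℝ} {t l E b F r : ℝ} (hr : 0 < r)
    (hb : 0 ≤ b) (hF : 0 ≤ F)
    (hFK : ∑ x ∈ superlevel P v t, truncation P v t x ^ 2 ≤ b * E)
    (hE : r * E ≤ 2 * F * ∑ x ∈ P, truncation P v t x) (htl : t ≤ l) :
    (l - t) * (superlevel P v l).card ≤ 2 * b * F / r * (superlevel P v t).card := by
  classical
  set S := superlevel P v t with hS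
  set φ := truncation P v t with hφ
  have hSP : S ⊆ P := fun x hx => (mem_superlevel.1 hx).1
  have hsum : ∑ x ∈ P, φ x = ∑ x ∈ S, φ x :=
    (Finset.sum_subset hSP fun x _ hx => by
      by_contra h
      exact hx (support_truncation_subset P v t h)).symm
  have hφ0 : ∀ x, 0 ≤ φ x := truncation_nonneg P v t
  set I := ∑ x ∈ S, φ x with hI
  have hI0 : 0 ≤ I := Finset.sum_nonneg fun x _ => hφ0 x
  have h1 : I ^ 2 ≤ S.card * ∑ x ∈ S, φ x ^ 2 := sq_sum_le_card_mul_sum_sq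
  have h2 : E ≤ 2 * F * I / r := by
    rw [le_div_iff₀ hr, mul_comm, ← hsum]
    exact hE
  -- Cauchy–Schwarz, Faber–Krahn and the energy bound leave one factor `I` on the right, which
  -- cancels against the square.
  have h3 : I ^ 2 ≤ (2 * b * F / r * S.card) * I := by
    calc I ^ 2 ≤ S.card * ∑ x ∈ S, φ x ^ 2 := h1
      _ ≤ S.card * (b * (2 * F * I / r)) := by
          gcongr
          exact hFK.trans (by gcongr)
      _ = _ := by ring
  have h4 : I ≤ 2 * b * F / r * S.card := by
    rcases hI0.eq_or_lt with h | h
    · rw [← h]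
      positivity
    · rw [sq] at h3
      exact le_of_mul_le_mul_right h3 h
  refine le_trans ?_ h4
  have hsub : superlevel P v l ⊆ S := fun x hx => by
    rw [mem_superlevel] at hx
    exact mem_superlevel.2 ⟨hx.1, htl.trans_lt hx.2⟩
  calc (l - t) * (superlevel P v l).card = ∑ x ∈ superlevel P v l, (l - t) := by
        rw [Finset.sum_const, nsmul_eq_mul, mul_comm]
    _ ≤ ∑ x ∈ superlevel P v l, φ x := by
        refine Finset.sum_le_sum fun x hx => ?_
        rw [mem_superlevel] at hx
        simp only [hφ, truncation, hx.1, if_true]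
        exact le_max_of_le_left (by linarith)
    _ ≤ I := Finset.sum_le_sum_of_subset_of_nonneg hsub fun x _ _ => hφ0 x

/-- Stampacchia iteration down to the scale `ρ`. All lengths are in units of the mesh size. -/
theorem exists_card_superlevel_le {P : Finset Γ} {v : Γ → ℝ} {d : ℕ} {B F r L ρ : ℝ} (hr : 0 < r)
    (hB : 0 < B) (hF : 0 < F) (hL : 0 < L) (hρ : 0 < ρ) (E : ℝ → ℝ)
    (hP : P.card ≤ L ^ d)
    (hFK : ∀ t l, 0 ≤ t → ρ ≤ l → (superlevel P v t).card ≤ l ^ d →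
      ∑ x ∈ superlevel P v t, truncation P v t x ^ 2 ≤ B * l ^ 2 * E t)
    (hE : ∀ t, 0 ≤ t → r * E t ≤ 2 * F * ∑ x ∈ P, truncation P v t x) :
    ∃ t, 0 ≤ t ∧ t ≤ 4 / 3 * (2 ^ (d + 1) * B * F / r * L ^ 2) ∧
      (superlevel P v t).card ≤ ρ ^ d := by
  -- With this `τ`, raising the level by `τ * l ^ 2` divides the cardinality bound by `2 ^ d` and so
  -- halves `l`. The increments form a geometric series of ratio `1 / 4`, whence the factor `4 / 3`.
  set τ := 2 ^ (d + 1) * B * F / r with hτ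
  have hτ0 : 0 < τ := by positivity
  have key : ∀ j : ℕ, ∃ t, 0 ≤ t ∧ t ≤ 4 / 3 * (τ * L ^ 2) * (1 - (1 / 4) ^ j) ∧
      ((superlevel P v t).card ≤ (L / 2 ^ j) ^ d ∨ (superlevel P v t).card ≤ ρ ^ d) := by
    intro j
    induction j with
    | zero =>
      refine ⟨0, le_rfl, by simp, Or.inl ?_⟩
      have : (superlevel P v 0).card ≤ P.card :=
        Finset.card_le_card fun x hx => (mem_superlevel.1 hx).1
      have h' : ((superlevel P v 0).card : ℝ) ≤ P.card := by exact_mod_cast this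
      simpa using h'.trans hP
    | succ j ih =>
      obtain ⟨t, ht0, htj, h⟩ := ih
      have hmono : (1 / 4 : ℝ) ^ (j + 1) ≤ (1 / 4) ^ j :=
        pow_le_pow_of_le_one (by norm_num) (by norm_num) (Nat.le_succ j)
      have htj' : t ≤ 4 / 3 * (τ * L ^ 2) * (1 - (1 / 4) ^ (j + 1)) :=
        htj.trans (by gcongr)
      rcases h with h | h
      swap
      · exact ⟨t, ht0, htj', Or.inr h⟩
      rcases lt_or_ge (L / 2 ^ j) ρ with hlt | hge
      · exact ⟨t, ht0, htj', Or.inr (h.trans (by gcongr))⟩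
      set l := L / 2 ^ j with hl
      have hl0 : 0 < l := by positivity
      have hll : l ^ 2 = L ^ 2 * (1 / 4) ^ j := by
        rw [hl, div_pow, ← pow_mul, mul_comm j 2, pow_mul, one_div, inv_pow, div_eq_mul_inv]
        norm_num
      refine ⟨t + τ * l ^ 2, by positivity, ?_, Or.inl ?_⟩
      · have h5 : (1 / 4 : ℝ) ^ (j + 1) = (1 / 4) ^ j / 4 := by ring
        rw [hll, h5]
        linarith
      · have h1 := mul_card_superlevel_le (l := t + τ * l ^ 2) hr (by positivity) hF.le
          (hFK t l ht0 hge h) (hE t ht0) (by linarith [mul_pos hτ0 (pow_pos hl0 2)])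
        have h2 : (t + τ * l ^ 2 - t) = 2 ^ d * (2 * (B * l ^ 2) * F / r) := by
          rw [hτ]
          ring
        rw [h2, mul_comm ((2 : ℝ) ^ d), mul_assoc] at h1
        have h3 := (le_of_mul_le_mul_left h1 (by positivity)).trans h
        have h4 : L / 2 ^ (j + 1) = l / 2 := by
          rw [hl, pow_succ]
          field_simp
        rw [h4, div_pow l, le_div_iff₀ (by positivity), mul_comm]
        exact h3
  obtain ⟨j, hj⟩ := pow_unbounded_of_one_lt (L / ρ) (one_lt_two (α := ℝ))
  obtain ⟨t, ht0, htj, h⟩ := key j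
  refine ⟨t, ht0, htj.trans ?_, ?_⟩
  · refine mul_le_of_le_one_right (by positivity) ?_
    linarith [pow_pos (by norm_num : (0 : ℝ) < 1 / 4) j]
  · rcases h with h | h
    · refine h.trans ?_
      have : L / 2 ^ j ≤ ρ := by
        rw [div_le_iff₀ (by positivity)]
        rw [div_lt_iff₀ hρ] at hj
        linarith
      gcongr
    · exact h

variable [AddCommGroup Γ]

/-- Energy (Caccioppoli) inequality for truncations of subsolutions of a symmetric difference
equation. -/
theorem sum_mul_translationEnergy_truncation_le {P N : Finset Γ} {Q : Set Γ} (hPQ : ↑P ⊆ Q)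
    (hN : ∀ z ∈ N, -z ∈ N) (hQ : ∀ x ∈ P, ∀ z ∈ N, x + z ∈ Q) {a : Γ → Γ → ℝ}
    (hsymm : ∀ x ∈ Q, ∀ y ∈ Q, a x y = a y x) {c : Γ → ℝ} {r : ℝ}
    (hc : ∀ z ∈ N, 0 ≤ r * c z)
    (ha : ∀ x ∈ Q, ∀ z ∈ N, x + z ∈ Q → r * c z ≤ a x (x + z)) {v : Γ → ℝ} {F : ℝ}
    (hv : ∀ x ∈ Q, x ∉ P → v x ≤ 0)
    (heq : ∀ x ∈ P, ∑ z ∈ N, a x (x + z) * (v x - v (x + z)) ≤ F) {t : ℝ} (ht : 0 ≤ t) :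
    r * ∑ z ∈ N, c z * translationEnergy (truncation P v t) z ≤
      2 * F * ∑ x ∈ P, truncation P v t x := by
  classical
  set φ := truncation P v t with hφ
  have hφ0 : ∀ x, 0 ≤ φ x := truncation_nonneg P v t
  have hφP : ∀ x, x ∉ P → φ x = 0 := fun x hx => by simp [hφ, truncation, hx]
  have hφQ : ∀ x ∈ Q, φ x = max (v x - t) 0 := by
    intro x hx
    by_cases h : x ∈ P
    · simp [hφ, truncation, h]
    · rw [hφP x h, max_eq_right]
      linarith [hv x hx h]
  have hfin : φ.support.Finite :=
    P.finite_toSet.subset fun x hx => by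
      by_contra h
      exact hx (hφP x h)
  let b : Γ → Γ → ℝ := fun z x => a x (x + z) * (v x - v (x + z)) * φ x
  -- The same edge tested from its other end. Since `N` is symmetric, `b` and `b'` have equal
  -- totals, while by symmetry of `a` their sum is `a` times the product of the increments of `v`
  -- and `φ`.
  let b' : Γ → Γ → ℝ := fun z x => a (x + z) x * (v (x + z) - v x) * φ (x + z)
  have hbs : ∀ z, Summable (b z) := fun z => summable_of_hasFiniteSupport (hfin.subset
    fun x hx => by intro h; exact hx (by simp [b, h]))
  have hb's : ∀ z, Summable (b' z) := fun z => summable_of_hasFiniteSupport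
    ((finite_support_translate hfin z).subset fun x hx => by
      intro h; exact hx (by simp only [b']; rw [show φ (x + z) = 0 from h, mul_zero]))
  have hbb' : ∀ z, ∑' x, b' z x = ∑' x, b (-z) x := by
    intro z
    rw [← (Equiv.addRight z).tsum_eq (b (-z))]
    simp [b, b']
  have hsum : ∑ z ∈ N, ∑' x, b z x = ∑ x ∈ P, (∑ z ∈ N, a x (x + z) * (v x - v (x + z))) * φ x := by
    rw [Finset.sum_congr rfl fun z _ => tsum_eq_sum (s := P) fun x hx => by simp [b, hφP x hx],
      Finset.sum_comm]
    exact Finset.sum_congr rfl fun x _ => by rw [Finset.sum_mul]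
  have hsum' : ∑ z ∈ N, ∑' x, b' z x = ∑ z ∈ N, ∑' x, b z x := by
    rw [Finset.sum_congr rfl fun z _ => hbb' z]
    exact Finset.sum_nbij' (fun z => -z) (fun z => -z) hN hN (by simp) (by simp) (by simp)
  have hle : ∑ z ∈ N, ∑' x, b z x ≤ F * ∑ x ∈ P, φ x := by
    rw [hsum, Finset.mul_sum]
    exact Finset.sum_le_sum fun x hx => mul_le_mul_of_nonneg_right (heq x hx) (hφ0 x)
  have hpt : ∀ z ∈ N, r * (c z * translationEnergy φ z) ≤ ∑' x, b z x + ∑' x, b' z x := by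
    intro z hz
    have hs : Summable fun x => (φ (x + z) - φ x) ^ 2 := by
      simpa using summable_sq_increment hfin z 0
    rw [← (hbs z).tsum_add (hb's z), ← mul_assoc, translationEnergy, ← tsum_mul_left]
    refine (hs.mul_left _).tsum_le_tsum (fun x => ?_) ((hbs z).add (hb's z))
    by_cases h : x ∈ Q ∧ x + z ∈ Q
    · obtain ⟨h1, h2⟩ := h
      have e : b z x + b' z x = a x (x + z) * ((v x - v (x + z)) * (φ x - φ (x + z))) := by
        simp only [b, b', hsymm (x + z) h2 x h1]
        ring
      rw [e]
      -- The truncation is a nondecreasing 1-Lipschitz function of `v`.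
      have h3 : (φ (x + z) - φ x) ^ 2 ≤ (v x - v (x + z)) * (φ x - φ (x + z)) := by
        rw [hφQ x h1, hφQ _ h2]
        rcases le_total (v x - t) 0 with h4 | h4 <;> rcases le_total (v (x + z) - t) 0 with h5 | h5
        · simp [max_eq_right h4, max_eq_right h5]
        · rw [max_eq_right h4, max_eq_left h5]
          nlinarith
        · rw [max_eq_left h4, max_eq_right h5]
          nlinarith
        · rw [max_eq_left h4, max_eq_left h5]
          nlinarith
      exact mul_le_mul (ha x h1 z hz h2) h3 (sq_nonneg _) ((hc z hz).trans (ha x h1 z hz h2))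
    -- An edge not contained in `Q` has both ends outside `P`, where the truncation vanishes.
    · have h1 : x ∉ P := fun hx => h ⟨hPQ hx, hQ x hx z hz⟩
      have h2 : x + z ∉ P := fun hx => h ⟨by simpa using hQ _ hx _ (hN z hz), hPQ hx⟩
      simp [b, b', hφP _ h1, hφP _ h2]
  calc r * ∑ z ∈ N, c z * translationEnergy φ z
      ≤ ∑ z ∈ N, (∑' x, b z x + ∑' x, b' z x) := by
        rw [Finset.mul_sum]
        exact Finset.sum_le_sum hpt
    _ ≤ 2 * F * ∑ x ∈ P, φ x := by
        rw [Finset.sum_add_distrib, hsum']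
        linarith

/-- Below the jump scale a subsolution is controlled by one jump: the jumps in `G` mostly leave a
small superlevel set. -/
theorem le_of_card_superlevel_le {P N G : Finset Γ} {Q : Set Γ} (hPQ : ↑P ⊆ Q)
    (hQ : ∀ x ∈ P, ∀ z ∈ N, x + z ∈ Q) (hGN : G ⊆ N) {a : Γ → Γ → ℝ} {c : Γ → ℝ} {r κ : ℝ}
    (hr : 0 < r) (hκ : 0 < κ) (hc : ∀ z ∈ N, 0 ≤ c z) (hcG : ∀ z ∈ G, κ ≤ c z)
    (ha : ∀ x ∈ Q, ∀ z ∈ N, x + z ∈ Q → r * c z ≤ a x (x + z)) {v : Γ → ℝ} {F t : ℝ}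
    (hv : ∀ x ∈ Q, x ∉ P → v x ≤ 0)
    (heq : ∀ x ∈ P, ∑ z ∈ N, a x (x + z) * (v x - v (x + z)) ≤ F) (ht : 0 ≤ t) (hF : 0 ≤ F)
    (hG : G.Nonempty) (hcard : 2 * (superlevel P v t).card ≤ G.card) :
    ∀ x ∈ P, v x ≤ t + 2 * F / (r * κ * G.card) := by
  classical
  have hGc : (0 : ℝ) < G.card := by exact_mod_cast hG.card_pos
  intro x₀ hx₀
  obtain ⟨x, hxP, hmax⟩ := P.exists_max_image v ⟨x₀, hx₀⟩
  refine (hmax x₀ hx₀).trans ?_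
  rcases le_or_gt (v x) t with h | h
  · exact h.trans (le_add_of_nonneg_right (by positivity))
  have hle : ∀ y ∈ Q, v y ≤ v x := fun y hy => by
    by_cases hyP : y ∈ P
    · exact hmax y hyP
    · exact (hv y hy hyP).trans (ht.trans h.le)
  -- Distinct jumps from the maximum point have distinct targets, so at most half of `G` can hit the
  -- superlevel set.
  set G' := G.filter fun z => x + z ∉ superlevel P v t with hG'
  have hG'c : (G.card : ℝ) ≤ 2 * G'.card := by
    have h1 : (G.filter fun z => x + z ∈ superlevel P v t).card ≤ (superlevel P v t).card :=
      Finset.card_le_card_of_injOn (fun z => x + z) (fun z hz => (Finset.mem_filter.1 hz).2)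
        fun a _ b _ hab => add_left_cancel hab
    have h2 := Finset.card_filter_add_card_filter_not (s := G)
      (fun z => x + z ∈ superlevel P v t)
    have h3 : G.card ≤ 2 * G'.card := by
      rw [hG']
      omega
    exact_mod_cast h3
  have hG'N : G' ⊆ N := (Finset.filter_subset _ _).trans hGN
  have h1 : ∑ z ∈ G', r * κ * (v x - t) ≤ ∑ z ∈ N, a x (x + z) * (v x - v (x + z)) := by
    have hnn : ∀ z ∈ N, 0 ≤ a x (x + z) * (v x - v (x + z)) := fun z hz =>
      mul_nonneg ((mul_nonneg hr.le (hc z hz)).trans (ha x (hPQ hxP) z hz (hQ x hxP z hz)))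
        (sub_nonneg.2 (hle _ (hQ x hxP z hz)))
    refine le_trans (Finset.sum_le_sum fun z hz => ?_)
      (Finset.sum_le_sum_of_subset_of_nonneg hG'N fun z hz _ => hnn z hz)
    obtain ⟨hzG, hzS⟩ := Finset.mem_filter.1 hz
    have hzN := hGN hzG
    have hzQ := hQ x hxP z hzN
    have h2 : v (x + z) ≤ t := by
      by_cases hP : x + z ∈ P
      · by_contra! h'
        exact hzS (mem_superlevel.2 ⟨hP, h'⟩)
      · exact (hv _ hzQ hP).trans ht
    have h3 : r * κ ≤ a x (x + z) :=
      (mul_le_mul_of_nonneg_left (hcG z hzG) hr.le).trans (ha x (hPQ hxP) z hzN hzQ)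
    have : 0 < r * κ := by positivity
    exact mul_le_mul h3 (by linarith) (by linarith) (by linarith)
  rw [Finset.sum_const, nsmul_eq_mul] at h1
  have h2 := h1.trans (heq x hxP)
  rw [← sub_le_iff_le_add', le_div_iff₀ (by positivity)]
  have h3 : 0 ≤ r * κ * (v x - t) := mul_nonneg (by positivity) (by linarith)
  nlinarith

end Truncation

end NonlocalMeshfree

namespace NonlocalMeshfree

/-! ### Lattice points, jumps and singular lattice sums -/

section Lattice

variable {d : ℕ}

/-- The point of the lattice `(hℤ)ᵈ` with integer coordinates `k`. -/
noncomputable def latticePoint (h : ℝ) (k : Fin d → ℤ) : Space d :=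
  WithLp.toLp 2 fun i => (k i : ℝ) * h

@[simp] theorem latticePoint_apply (h : ℝ) (k : Fin d → ℤ) (i : Fin d) :
    latticePoint h k i = k i * h := rfl

theorem latticePoint_add (h : ℝ) (k l : Fin d → ℤ) :
    latticePoint h (k + l) = latticePoint h k + latticePoint h l := by
  ext i
  simp [add_mul]

theorem latticePoint_neg (h : ℝ) (k : Fin d → ℤ) :
    latticePoint h (-k) = -latticePoint h k := by
  ext i
  simp

@[simp] theorem latticePoint_zero (h : ℝ) : latticePoint h (0 : Fin d → ℤ) = 0 := by
  ext i
  simp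

theorem latticePoint_injective {h : ℝ} (hh : 0 < h) :
    Function.Injective (latticePoint h : (Fin d → ℤ) → Space d) := by
  intro k l hkl
  ext i
  have := congrArg (fun x : Space d => x i) hkl
  simpa [hh.ne'] using this

theorem mem_lattice_iff {h : ℝ} {x : Space d} : x ∈ lattice d h ↔ ∃ k, latticePoint h k = x := by
  constructor
  · rintro ⟨k, hk⟩
    exact ⟨k, by ext i; simp [hk i]⟩
  · rintro ⟨k, rfl⟩
    exact ⟨k, fun i => rfl⟩

theorem norm_latticePoint_sq (h : ℝ) (k : Fin d → ℤ) :
    ‖latticePoint h k‖ ^ 2 = h ^ 2 * ∑ i, (k i : ℝ) ^ 2 := by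
  rw [EuclideanSpace.norm_sq_eq, Finset.mul_sum]
  refine Finset.sum_congr rfl fun i _ => ?_
  rw [latticePoint_apply, Real.norm_eq_abs, sq_abs]
  ring

theorem norm_latticePoint_eq_mul {h : ℝ} (hh : 0 < h) (k : Fin d → ℤ) :
    ‖latticePoint h k‖ = h * ‖latticePoint 1 k‖ := by
  have : latticePoint h k = h • latticePoint 1 k := by
    ext i
    simp [mul_comm]
  rw [this, norm_smul, Real.norm_of_nonneg hh.le]

theorem abs_le_norm_latticePoint_one (k : Fin d → ℤ) (i : Fin d) :
    |(k i : ℝ)| ≤ ‖latticePoint 1 k‖ := by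
  simpa using PiLp.norm_apply_le (latticePoint 1 k) i

theorem norm_latticePoint_single_sq (h : ℝ) (i : Fin d) (g : ℤ) :
    ‖latticePoint h (Pi.single i g)‖ ^ 2 = (g * h) ^ 2 := by
  rw [norm_latticePoint_sq, Finset.sum_eq_single i]
  · simp
    ring
  · intro j _ hj
    simp [hj]
  · simp

/-- The discrete cube of all integer vectors with coordinates of absolute value at most `m`. -/
noncomputable def box (d : ℕ) (m : ℤ) : Finset (Fin d → ℤ) := Fintype.piFinset fun _ => Finset.Icc (-m) m

theorem mem_box {m : ℤ} {k : Fin d → ℤ} : k ∈ box d m ↔ ∀ i, |k i| ≤ m := by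
  simp [box, Fintype.mem_piFinset, abs_le]

theorem card_box (m : ℕ) : (box d m).card = (2 * m + 1) ^ d := by
  have : ((m : ℤ) + 1 + m).toNat = 2 * m + 1 := by omega
  simp [box, Fintype.card_piFinset, this]

open Classical in
/-- The nonzero integer vectors `k` with `|hk| < δ`. -/
noncomputable def jumps (d : ℕ) (h δ : ℝ) : Finset (Fin d → ℤ) :=
  (box d ⌈δ / h⌉).filter fun k => k ≠ 0 ∧ ‖latticePoint h k‖ < δ

theorem mem_box_of_norm_lt {h δ : ℝ} (hh : 0 < h) {k : Fin d → ℤ} (hk : ‖latticePoint h k‖ < δ)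
    {m : ℤ} (hm : δ / h ≤ m) : k ∈ box d m := by
  refine mem_box.2 fun i => ?_
  have h1 := abs_le_norm_latticePoint_one k i
  have h2 : ‖latticePoint 1 k‖ < δ / h := by
    rw [lt_div_iff₀ hh, mul_comm, ← norm_latticePoint_eq_mul hh]
    exact hk
  have h3 : |(k i : ℝ)| ≤ m := by linarith
  exact_mod_cast h3

theorem mem_jumps {h δ : ℝ} (hh : 0 < h) {k : Fin d → ℤ} :
    k ∈ jumps d h δ ↔ k ≠ 0 ∧ ‖latticePoint h k‖ < δ := by
  simp only [jumps, Finset.mem_filter, and_iff_right_iff_imp]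
  exact fun hk => mem_box_of_norm_lt hh hk.2 (Int.le_ceil _)

theorem neg_mem_jumps {h δ : ℝ} (hh : 0 < h) {k : Fin d → ℤ} (hk : k ∈ jumps d h δ) :
    -k ∈ jumps d h δ := by
  rw [mem_jumps hh] at hk ⊢
  rw [latticePoint_neg, norm_neg]
  exact ⟨neg_ne_zero.2 hk.1, hk.2⟩

theorem one_le_norm_latticePoint_one {k : Fin d → ℤ} (hk : k ≠ 0) : 1 ≤ ‖latticePoint 1 k‖ := by
  obtain ⟨i, hi⟩ := Function.ne_iff.1 hk
  refine le_trans ?_ (abs_le_norm_latticePoint_one k i)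
  exact_mod_cast Int.one_le_abs hi

theorem norm_latticePoint_pos {h : ℝ} (hh : 0 < h) {k : Fin d → ℤ} (hk : k ≠ 0) :
    0 < ‖latticePoint h k‖ := by
  rw [norm_latticePoint_eq_mul hh]
  exact mul_pos hh (one_pos.trans_le (one_le_norm_latticePoint_one hk))

-- The dyadic shell beyond radius `2 ^ J` has at most `(5 * 2 ^ J) ^ d` points, each contributing at
-- most `(2 ^ J) ^ (-s)`. As `s < d`, the shell sums grow geometrically and the last one dominates.
open Classical in
theorem exists_sum_box_inv_norm_rpow_le (d : ℕ) {s : ℝ} (hs : 0 ≤ s) (hsd : s < d) :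
    ∃ C : ℝ, 0 < C ∧ ∀ J : ℕ, ∑ k ∈ (box d (2 ^ J : ℕ)).filter (· ≠ 0),
      (‖latticePoint 1 k‖ ^ s)⁻¹ ≤ C * ((2 : ℝ) ^ J) ^ ((d : ℝ) - s) := by
  set q : ℝ := 2 ^ ((d : ℝ) - s) with hq
  have hq1 : 1 < q := Real.one_lt_rpow one_lt_two (by linarith)
  have hqJ : ∀ J : ℕ, ((2 : ℝ) ^ J) ^ ((d : ℝ) - s) = q ^ J := fun J => by
    rw [hq, ← Real.rpow_natCast, ← Real.rpow_natCast, ← Real.rpow_mul two_pos.le,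
      ← Real.rpow_mul two_pos.le, mul_comm]
  have hC0 : 0 < q - 1 := by linarith
  -- The first summand lets `C * (q - 1)` absorb each new shell in the induction; the second covers
  -- the unit box.
  set C : ℝ := 5 ^ d / (q - 1) + 5 ^ d with hC
  have hCq : 5 ^ d ≤ C * (q - 1) := by
    rw [hC, add_mul, div_mul_cancel₀ _ hC0.ne']
    exact le_add_of_nonneg_right (by positivity)
  refine ⟨C, by positivity, fun J => ?_⟩
  rw [hqJ]
  induction J with
  | zero =>
    calc _ ≤ ∑ k ∈ (box d (2 ^ 0 : ℕ)).filter (· ≠ 0), (1 : ℝ) := by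
          refine Finset.sum_le_sum fun k hk => ?_
          exact inv_le_one_of_one_le₀ (Real.one_le_rpow
            (one_le_norm_latticePoint_one (Finset.mem_filter.1 hk).2) hs)
      _ ≤ (box d (2 ^ 0 : ℕ)).card := by
          rw [Finset.sum_const, nsmul_eq_mul, mul_one]
          exact_mod_cast Finset.card_filter_le _ _
      _ ≤ 5 ^ d := by
          rw [card_box]
          push_cast
          gcongr
          norm_num
      _ ≤ C * q ^ 0 := by
          rw [hC, pow_zero, mul_one]
          exact le_add_of_nonneg_left (by positivity)
  | succ J ih =>
    have hsub : (box d (2 ^ (J + 1) : ℕ)).filter (· ≠ 0) ⊆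
        (box d (2 ^ J : ℕ)).filter (· ≠ 0) ∪
          (box d (2 ^ (J + 1) : ℕ)).filter (· ∉ box d (2 ^ J : ℕ)) := by
      intro k hk
      rw [Finset.mem_filter] at hk
      by_cases h : k ∈ box d (2 ^ J : ℕ)
      · exact Finset.mem_union_left _ (Finset.mem_filter.2 ⟨h, hk.2⟩)
      · exact Finset.mem_union_right _ (Finset.mem_filter.2 ⟨hk.1, h⟩)
    have hshell : ∑ k ∈ (box d (2 ^ (J + 1) : ℕ)).filter (· ∉ box d (2 ^ J : ℕ)),
        (‖latticePoint 1 k‖ ^ s)⁻¹ ≤ 5 ^ d * q ^ J := by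
      calc _ ≤ ∑ k ∈ (box d (2 ^ (J + 1) : ℕ)).filter (· ∉ box d (2 ^ J : ℕ)),
            (((2 : ℝ) ^ J) ^ s)⁻¹ := by
            refine Finset.sum_le_sum fun k hk => ?_
            have h1 := (Finset.mem_filter.1 hk).2
            rw [mem_box] at h1
            push Not at h1
            obtain ⟨i, hi⟩ := h1
            have h2 : (2 : ℝ) ^ J ≤ |(k i : ℝ)| := by exact_mod_cast hi.le
            have h3 := h2.trans (abs_le_norm_latticePoint_one k i)
            gcongr
        _ ≤ ((2 : ℝ) * 2 ^ (J + 1) + 1) ^ d * (((2 : ℝ) ^ J) ^ s)⁻¹ := by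
            rw [Finset.sum_const, nsmul_eq_mul]
            gcongr
            have : ((box d (2 ^ (J + 1) : ℕ)).filter (· ∉ box d (2 ^ J : ℕ))).card ≤
              (2 * 2 ^ (J + 1) + 1) ^ d := (Finset.card_filter_le _ _).trans (card_box _).le
            exact_mod_cast this
        _ ≤ ((5 : ℝ) * 2 ^ J) ^ d * (((2 : ℝ) ^ J) ^ s)⁻¹ := by
            gcongr
            have : (1 : ℝ) ≤ 2 ^ J := one_le_pow₀ one_le_two
            rw [pow_succ]
            linarith
        _ = 5 ^ d * q ^ J := by
            rw [← hqJ, Real.rpow_sub (by positivity), Real.rpow_natCast, mul_pow]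
            ring
    calc _ ≤ _ := Finset.sum_le_sum_of_subset_of_nonneg hsub fun k _ _ => by positivity
      _ = _ := Finset.sum_union (Finset.disjoint_left.2 fun k hk hk' =>
          (Finset.mem_filter.1 hk').2 (Finset.mem_filter.1 hk).1)
      _ ≤ C * q ^ J + 5 ^ d * q ^ J := add_le_add ih hshell
      _ ≤ C * q ^ (J + 1) := by
          rw [pow_succ]
          nlinarith [pow_pos (by linarith : 0 < q) J]

/-- The discrete counterpart of the integrability of `|z| ^ (-s)`. Enlarging `δ / h` to a power of
two costs only the factor `2 ^ (d - s)`. -/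
theorem exists_sum_jumps_inv_norm_rpow_le (d : ℕ) {s : ℝ} (hs : 0 ≤ s) (hsd : s < d) :
    ∃ C : ℝ, 0 < C ∧ ∀ h δ : ℝ, 0 < h → h ≤ δ → ∑ k ∈ jumps d h δ,
      (‖latticePoint h k‖ ^ s)⁻¹ ≤ C * (δ ^ d / (h ^ d * δ ^ s)) := by
  classical
  obtain ⟨C, hC, hbox⟩ := exists_sum_box_inv_norm_rpow_le d hs hsd
  refine ⟨C * 2 ^ ((d : ℝ) - s), by positivity, fun h δ hh hδ => ?_⟩
  have hδ0 : 0 < δ := hh.trans_le hδ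
  obtain ⟨j, hj1, hj2⟩ := exists_nat_pow_near ((one_le_div₀ hh).2 hδ) (one_lt_two (α := ℝ))
  have hsub : jumps d h δ ⊆ (box d (2 ^ (j + 1) : ℕ)).filter (· ≠ 0) := by
    intro k hk
    rw [mem_jumps hh] at hk
    refine Finset.mem_filter.2 ⟨mem_box_of_norm_lt hh hk.2 ?_, hk.1⟩
    push_cast
    exact hj2.le
  calc ∑ k ∈ jumps d h δ, (‖latticePoint h k‖ ^ s)⁻¹
      = (h ^ s)⁻¹ * ∑ k ∈ jumps d h δ, (‖latticePoint 1 k‖ ^ s)⁻¹ := by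
        rw [Finset.mul_sum]
        refine Finset.sum_congr rfl fun k _ => ?_
        rw [norm_latticePoint_eq_mul hh, Real.mul_rpow hh.le (norm_nonneg _), mul_inv]
    _ ≤ (h ^ s)⁻¹ * (C * ((2 : ℝ) ^ (j + 1)) ^ ((d : ℝ) - s)) := by
        gcongr
        exact (Finset.sum_le_sum_of_subset_of_nonneg hsub fun k _ _ => by positivity).trans
          (hbox (j + 1))
    _ ≤ (h ^ s)⁻¹ * (C * (2 * (δ / h)) ^ ((d : ℝ) - s)) := by
        gcongr
        rw [pow_succ]
        linarith
    _ = C * 2 ^ ((d : ℝ) - s) * (δ ^ d / (h ^ d * δ ^ s)) := by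
        rw [Real.mul_rpow two_pos.le (by positivity), Real.div_rpow hδ0.le hh.le,
          Real.rpow_sub hδ0, Real.rpow_sub hh, Real.rpow_natCast, Real.rpow_natCast]
        have h1 : 0 < h ^ s := by positivity
        have h2 : 0 < δ ^ s := by positivity
        field_simp

end Lattice

end NonlocalMeshfree

namespace NonlocalMeshfree

/-! ### Lower bounds for the conductances -/

section Conductance

variable {d : ℕ}

theorem div_pow_le_kernel {s δ ρ : ℝ} (hs : 0 ≤ s) (hD : 0 ≤ kernelConst d s) (hρ : 0 < ρ)
    (hρδ : ρ < δ) : kernelConst d s / δ ^ (d + 2) ≤ kernel d s δ ρ := by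
  have hδ : 0 < δ := hρ.trans hρδ
  rw [kernel, if_pos hρδ]
  have h1 : δ ^ (d + 2) = δ ^ ((d : ℝ) + 2 - s) * δ ^ s := by
    rw [← Real.rpow_add hδ, ← Real.rpow_natCast]
    push_cast
    ring_nf
  rw [h1]
  gcongr

theorem sum_jumps_kernel_le {s C h δ : ℝ} (hD : 0 ≤ kernelConst d s) (hh : 0 < h) (hδ : 0 < δ)
    (hC : ∑ k ∈ jumps d h δ, (‖latticePoint h k‖ ^ s)⁻¹ ≤ C * (δ ^ d / (h ^ d * δ ^ s))) :
    ∑ k ∈ jumps d h δ, kernel d s δ ‖latticePoint h k‖ ≤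
      kernelConst d s * C / (δ ^ 2 * h ^ d) := by
  have h1 : ∀ k ∈ jumps d h δ, kernel d s δ ‖latticePoint h k‖ =
      kernelConst d s / δ ^ ((d : ℝ) + 2 - s) * (‖latticePoint h k‖ ^ s)⁻¹ := by
    intro k hk
    rw [kernel, if_pos ((mem_jumps hh).1 hk).2]
    field_simp
  rw [Finset.sum_congr rfl h1, ← Finset.mul_sum]
  refine (mul_le_mul_of_nonneg_left hC (by positivity)).trans (le_of_eq ?_)
  rw [Real.rpow_sub hδ, Real.rpow_add hδ, Real.rpow_natCast, Real.rpow_two]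
  have h2 : 0 < δ ^ s := by positivity
  field_simp

/-- A positive radial quadratic weight is bounded below, away from the ends of its range, by a
multiple of an upper bound `M`. -/
theorem exists_upper_bound_radialWeight [NeZero d] {h δ α β : ℝ} (hh : 0 < h) (hδ : 2 * h < δ)
    (hpos : ∀ k ∈ jumps d h δ, 0 < α + β * ‖latticePoint h k‖ ^ 2) :
    ∃ M, (∀ k ∈ jumps d h δ, α + β * ‖latticePoint h k‖ ^ 2 ≤ M) ∧ 0 < M ∧
      ∃ g : ℤ, 2 ≤ g ∧ g * h < δ ∧ δ ≤ (g + 1) * h ∧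
        ((∀ k ∈ jumps d h δ,
            M * ((‖latticePoint h k‖ ^ 2 - h ^ 2) / δ ^ 2) ≤ α + β * ‖latticePoint h k‖ ^ 2) ∨
          ∀ k ∈ jumps d h δ,
            M * (1 - ‖latticePoint h k‖ ^ 2 / (g * h) ^ 2) ≤ α + β * ‖latticePoint h k‖ ^ 2) := by
  have hδ0 : 0 < δ := by linarith
  -- The largest integer with `g * h < δ`, that is, the longest axis jump.
  set g : ℤ := ⌈δ / h⌉ - 1 with hg
  have hgδ : g * h < δ := by
    have : (g : ℝ) < δ / h := by
      have := Int.ceil_lt_add_one (δ / h)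
      rw [hg]
      push_cast
      linarith
    rwa [lt_div_iff₀ hh] at this
  have hδg : δ ≤ (g + 1) * h := by
    rw [← div_le_iff₀ hh, hg]
    push_cast
    linarith [Int.le_ceil (δ / h)]
  have hg2 : 2 ≤ g := by
    have : (2 : ℝ) < g + 1 := by
      have h1 : 2 * h < (g + 1) * h := by linarith
      exact lt_of_mul_lt_mul_right h1 hh.le
    have : (2 : ℤ) < g + 1 := by exact_mod_cast this
    omega
  have hg2' : (2 : ℝ) ≤ g := by exact_mod_cast hg2
  have hsingle : ∀ m : ℤ, 0 < m → m * h < δ → Pi.single (0 : Fin d) m ∈ jumps d h δ := by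
    intro m hm hmδ
    rw [mem_jumps hh]
    refine ⟨by simp [hm.ne'], ?_⟩
    have hm' : (0 : ℝ) < m := by exact_mod_cast hm
    rw [← Real.sqrt_sq (norm_nonneg _), norm_latticePoint_single_sq,
      Real.sqrt_sq (by positivity)]
    exact hmδ
  have h1 := hpos _ (hsingle 1 one_pos (by push_cast; linarith))
  have h2 := hpos _ (hsingle g (by omega) hgδ)
  rw [norm_latticePoint_single_sq] at h1 h2
  push_cast at h1
  rw [one_mul] at h1
  have hρ : ∀ k ∈ jumps d h δ, h ^ 2 ≤ ‖latticePoint h k‖ ^ 2 ∧ ‖latticePoint h k‖ ^ 2 ≤ δ ^ 2 := by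
    intro k hk
    obtain ⟨hk0, hkδ⟩ := (mem_jumps hh).1 hk
    have h3 := one_le_norm_latticePoint_one hk0
    have h4 : h ≤ ‖latticePoint h k‖ := by
      rw [norm_latticePoint_eq_mul hh]
      nlinarith
    exact ⟨by gcongr, by gcongr⟩
  have hh2 : h ^ 2 < δ ^ 2 := by
    have : h < δ := by linarith
    gcongr
  -- If the weight is nondecreasing in the radius, its value at `δ` serves as `M` and positivity at
  -- radius `h` bounds it below. If it is decreasing, `M = α` and positivity at radius `g * h` does.
  rcases le_or_gt 0 β with hβ | hβ
  · refine ⟨α + β * δ ^ 2, fun k hk => ?_, by nlinarith, g, hg2, hgδ, hδg, Or.inl fun k hk => ?_⟩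
    · linarith [mul_le_mul_of_nonneg_left (hρ k hk).2 hβ]
    · obtain ⟨h3, h4⟩ := hρ k hk
      rw [mul_div_assoc', div_le_iff₀ (by positivity)]
      set ρ := ‖latticePoint h k‖ ^ 2
      have h5 : 0 ≤ (α + β * h ^ 2) * (δ ^ 2 - ρ + h ^ 2) :=
        mul_nonneg h1.le (by nlinarith [sq_nonneg h])
      have h6 : 0 ≤ β * h ^ 2 * (ρ - h ^ 2) := mul_nonneg (by positivity) (by linarith)
      nlinarith
  · refine ⟨α, fun k hk => ?_, by nlinarith [sq_nonneg h], g, hg2, hgδ, hδg,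
      Or.inr fun k hk => ?_⟩
    · nlinarith [sq_nonneg ‖latticePoint h k‖]
    · have hG : 0 < ((g : ℝ) * h) ^ 2 := by positivity
      set ρ := ‖latticePoint h k‖ ^ 2
      set G := ((g : ℝ) * h) ^ 2
      have h3 : 0 ≤ (α + β * G) * (ρ / G) := mul_nonneg h2.le (by positivity)
      have h4 : (α + β * G) * (ρ / G) = α * (ρ / G) + β * ρ := by field_simp
      linarith

/-- The Faber–Krahn inequality for a set `G` of jumps whose weights are comparable to
`(h / δ) ^ d`. -/
def SatisfiesFaberKrahn (d : ℕ) (h δ : ℝ) (G : Finset (Fin d → ℤ)) : Prop :=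
  2 * (δ / (16 * d * h)) ^ d ≤ (G.card : ℝ) ∧
    ∀ φ : (Fin d → ℤ) → ℝ, (∀ x, 0 ≤ φ x) → ∀ S : Finset (Fin d → ℤ), φ.support ⊆ S →
      ∀ L : ℝ, δ / (16 * d * h) ≤ L → (S.card : ℝ) ≤ L ^ d →
        ∑ x ∈ S, φ x ^ 2 ≤ 324 * d ^ 3 * (8 * d) ^ (d + 2) * L ^ 2 * (h / δ) ^ (d + 2) *
          ∑ z ∈ G, translationEnergy φ z

theorem card_bound_of_le {d : ℕ} [NeZero d] {S : ℕ} {L : ℝ} {m : ℕ} (hS : (S : ℝ) ≤ L ^ d)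
    (hL : 0 ≤ L) (hm : 2 * L ≤ m) : 2 * S ≤ m ^ d := by
  have h1 : 2 * (S : ℝ) ≤ (m : ℝ) ^ d := by
    calc 2 * (S : ℝ) ≤ 2 ^ d * L ^ d := by
          gcongr
          exact le_self_pow₀ one_le_two (NeZero.ne d)
      _ = (2 * L) ^ d := (mul_pow _ _ _).symm
      _ ≤ (m : ℝ) ^ d := by gcongr
  exact_mod_cast h1

/-- For `δ ≥ 8dh` the side `n` is at least two and comparable to `δ / h`. The `K ^ 2` of the cube
inequality contributes `(L * h / δ) ^ 2` and the division by `n ^ d` contributes `(h / δ) ^ d`. -/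
theorem satisfiesFaberKrahn_cube [NeZero d] {h δ : ℝ} (hh : 0 < h) (hδ : 8 * d * h ≤ δ) :
    SatisfiesFaberKrahn d h δ
      (Fintype.piFinset fun _ => Finset.Icc (⌊δ / (4 * d * h)⌋₊ : ℤ)
        (2 * ⌊δ / (4 * d * h)⌋₊)) := by
  have hd : (1 : ℝ) ≤ d := by exact_mod_cast NeZero.one_le (n := d)
  have hδ0 : 0 < δ := lt_of_lt_of_le (by positivity) hδ
  set n := ⌊δ / (4 * d * h)⌋₊ with hn
  set x := δ / (4 * d * h) with hx
  have hx2 : 2 ≤ x := by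
    rw [hx, le_div_iff₀ (by positivity)]
    linarith
  have hnx : (n : ℝ) ≤ x := Nat.floor_le (by linarith)
  have hxn : x < n + 1 := Nat.lt_floor_add_one x
  have hnx2 : x / 2 ≤ n := by linarith
  have hn0 : (0 : ℝ) < n := by linarith
  have hx4 : δ / (16 * d * h) = x / 4 := by
    rw [hx]
    field_simp
    norm_num
  rw [SatisfiesFaberKrahn, hx4]
  refine ⟨?_, fun φ hφ S hS L hL hSL => ?_⟩
  · have h1 : (Fintype.piFinset fun _ : Fin d => Finset.Icc (n : ℤ) (2 * n)).card =
        (n + 1) ^ d := by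
      have : (2 * (n : ℤ) + 1 - n).toNat = n + 1 := by omega
      simp only [Fintype.card_piFinset, Int.card_Icc, this, Finset.prod_const, Finset.card_univ,
        Fintype.card_fin]
    rw [h1]
    calc 2 * (x / 4) ^ d ≤ 2 ^ d * (x / 4) ^ d := by
          gcongr
          exact le_self_pow₀ one_le_two (NeZero.ne d)
      _ = (x / 2) ^ d := by rw [← mul_pow]; ring
      _ ≤ (((n + 1) ^ d : ℕ) : ℝ) := by
          push_cast
          gcongr
          linarith
  · have hL0 : 0 < L := by linarith
    set K := ⌈2 * L / n⌉₊ with hK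
    have hKL : 2 * L / n ≤ K := Nat.le_ceil _
    have hK0 : 0 < K := Nat.ceil_pos.2 (by positivity)
    have hKu : (K : ℝ) ≤ 8 * L / x := by
      have h1 : (K : ℝ) < 2 * L / n + 1 := Nat.ceil_lt_add_one (by positivity)
      have h2 : 2 * L / n ≤ 2 * L / (x / 2) := by gcongr
      have h3 : 2 * L / (x / 2) = 4 * L / x := by field_simp; norm_num
      have h4 : 1 ≤ 4 * L / x := by
        rw [one_le_div (by linarith)]
        linarith
      have h5 : 8 * L / x = 4 * L / x + 4 * L / x := by ring
      linarith
    have hcard : 2 * S.card ≤ (K * n) ^ d := by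
      refine card_bound_of_le hSL hL0.le ?_
      push_cast
      rwa [div_le_iff₀ hn0] at hKL
    have h1 := sum_sq_le_sum_cube_translationEnergy hφ hS hK0 hcard
    set T := ∑ w ∈ Fintype.piFinset fun _ : Fin d => Finset.Icc (n : ℤ) (2 * n),
      translationEnergy φ w
    have hT : 0 ≤ T := Finset.sum_nonneg fun _ _ => translationEnergy_nonneg _ _
    have h2 : (x / 2) ^ d * ∑ y ∈ S, φ y ^ 2 ≤ (8 * L / x) ^ 2 * T := by
      refine le_trans ?_ (h1.trans ?_)
      · have := Finset.sum_nonneg fun y (_ : y ∈ S) => sq_nonneg (φ y)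
        have hx0 : 0 ≤ x / 2 := by linarith
        gcongr
      · gcongr
    have h3 : ∑ y ∈ S, φ y ^ 2 ≤ (8 * L / x) ^ 2 * T / (x / 2) ^ d := by
      rw [le_div_iff₀ (by positivity), mul_comm]
      exact h2
    refine h3.trans ?_
    have e1 : x / 2 = (8 * d * (h / δ))⁻¹ := by
      rw [hx]
      field_simp
      norm_num
    have e2 : 8 * L / x = 4 * (8 * d * (h / δ)) * L := by
      rw [hx]
      field_simp
    rw [e1, e2, inv_pow, div_inv_eq_mul, pow_add, pow_add]
    have h4 : 0 ≤ (8 * d * (h / δ)) ^ (d + 2) * L ^ 2 * T := by positivity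
    have h5 : (16 : ℝ) ≤ 324 * d ^ 3 := by
      have : (1 : ℝ) ≤ d ^ 3 := one_le_pow₀ hd
      linarith
    calc (4 * (8 * d * (h / δ)) * L) ^ 2 * T * (8 * d * (h / δ)) ^ d
        = 16 * ((8 * d * (h / δ)) ^ (d + 2) * L ^ 2 * T) := by ring
      _ ≤ 324 * d ^ 3 * ((8 * d * (h / δ)) ^ (d + 2) * L ^ 2 * T) := by gcongr
      _ = _ := by rw [pow_add, mul_pow, mul_pow (8 * (d : ℝ)) (h / δ)]; ring

/-- Here the range is a bounded number of mesh sizes, so `(8 * d * h / δ) ^ (d + 2) ≥ 1` and axis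
jumps alone suffice. The lower bound on `δ` makes `L` bounded below, so rounding `2 * L` up is
harmless. -/
theorem satisfiesFaberKrahn_axis [NeZero d] {h δ : ℝ} (hh : 0 < h) (hhδ : h < δ)
    (hδ : δ ≤ 8 * d * h) {g : ℤ} (hg : g ≠ 0) :
    SatisfiesFaberKrahn d h δ (Finset.univ.image fun i => Pi.single i g) := by
  classical
  have hd : (1 : ℝ) ≤ d := by exact_mod_cast NeZero.one_le (n := d)
  have hδ0 : 0 < δ := hh.trans hhδ
  have hinj : Function.Injective fun i : Fin d => (Pi.single i g : Fin d → ℤ) := by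
    intro i j hij
    by_contra hne
    have := congrFun hij i
    simp [hne, hg] at this
  have hle : δ / (16 * d * h) ≤ 1 / 2 := by
    rw [div_le_iff₀ (by positivity)]
    linarith
  refine ⟨?_, fun φ hφ S hS L hL hSL => ?_⟩
  · rw [Finset.card_image_of_injective _ hinj, Finset.card_univ, Fintype.card_fin]
    calc 2 * (δ / (16 * d * h)) ^ d ≤ 2 * (1 / 2) := by
          gcongr
          exact (pow_le_pow_left₀ (by positivity) hle d).trans
            (pow_le_of_le_one (by norm_num) (by norm_num) (NeZero.ne d))
      _ ≤ d := by linarith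
  · have hL1 : 1 ≤ 16 * d * L := by
      rw [div_le_iff₀ (by positivity)] at hL
      have : h * 1 ≤ h * (16 * d * L) := by linarith
      exact le_of_mul_le_mul_left this hh
    have hL0 : 0 < L := by
      by_contra! h0
      nlinarith
    set K := ⌈2 * L⌉₊ with hK
    have hKL : 2 * L ≤ K := Nat.le_ceil _
    have hK0 : 0 < K := Nat.ceil_pos.2 (by positivity)
    have hKu : (K : ℝ) ≤ 18 * d * L := by
      have h1 : (K : ℝ) < 2 * L + 1 := Nat.ceil_lt_add_one (by positivity)
      nlinarith
    have h1 := sum_sq_le_sum_axis_translationEnergy hφ hS hK0 hg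
      (card_bound_of_le hSL hL0.le hKL)
    rw [Finset.sum_image fun i _ j _ hij => hinj hij]
    set T := ∑ i : Fin d, translationEnergy φ (Pi.single i g)
    have hT : 0 ≤ T := Finset.sum_nonneg fun _ _ => translationEnergy_nonneg _ _
    have h2 : 1 ≤ (8 * d * (h / δ)) ^ (d + 2) := by
      refine one_le_pow₀ ?_
      rw [← mul_div_assoc, one_le_div hδ0]
      exact hδ
    calc ∑ x ∈ S, φ x ^ 2 ≤ d * K ^ 2 * T := h1
      _ ≤ d * (18 * d * L) ^ 2 * T := by gcongr
      _ = 324 * d ^ 3 * L ^ 2 * T * 1 := by ring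
      _ ≤ 324 * d ^ 3 * L ^ 2 * T * (8 * d * (h / δ)) ^ (d + 2) := by gcongr
      _ = _ := by rw [mul_pow]; ring

theorem exists_jumps_satisfiesFaberKrahn [NeZero d] {s v C h δ α β : ℝ} (hs : 0 ≤ s)
    (hD : 0 < kernelConst d s) (hv : 0 < v) (hC : 0 < C) (hh : 0 < h) (hδ : 2 * h < δ)
    (hpos : ∀ k ∈ jumps d h δ, 0 < α + β * ‖latticePoint h k‖ ^ 2)
    (hsum : ∑ k ∈ jumps d h δ, (‖latticePoint h k‖ ^ s)⁻¹ ≤ C * (δ ^ d / (h ^ d * δ ^ s)))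
    (hmass : kernelConst d s * v / δ ^ 2 ≤ ∑ k ∈ jumps d h δ,
      kernel d s δ ‖latticePoint h k‖ * (α + β * ‖latticePoint h k‖ ^ 2)) :
    ∃ G ⊆ jumps d h δ, SatisfiesFaberKrahn d h δ G ∧ ∀ k ∈ G,
      kernelConst d s * v / (100 * d ^ 2 * C) * (h / δ) ^ d / δ ^ 2 ≤
        kernel d s δ ‖latticePoint h k‖ * (α + β * ‖latticePoint h k‖ ^ 2) := by
  classical
  have hd : (1 : ℝ) ≤ d := by exact_mod_cast NeZero.one_le (n := d)
  have hδ0 : 0 < δ := by linarith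
  obtain ⟨M, hM, hM0, g, hg2, hgδ, hδg, hcase⟩ := exists_upper_bound_radialWeight hh hδ hpos
  have hg2' : (2 : ℝ) ≤ g := by exact_mod_cast hg2
  have hkpos : ∀ k ∈ jumps d h δ, kernelConst d s / δ ^ (d + 2) ≤
      kernel d s δ ‖latticePoint h k‖ := fun k hk =>
    div_pow_le_kernel hs hD.le (norm_latticePoint_pos hh ((mem_jumps hh).1 hk).1)
      ((mem_jumps hh).1 hk).2
  -- The weighted kernel sum is at most `M` times the kernel sum, which is of order `1 / (δ ^ 2 * h
  -- ^ d)`, while its mass is at least of order `1 / δ ^ 2`.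
  have hMlow : v / C * h ^ d ≤ M := by
    have h1 : kernelConst d s * v / δ ^ 2 ≤ kernelConst d s * C / (δ ^ 2 * h ^ d) * M := by
      refine hmass.trans ?_
      refine le_trans (Finset.sum_le_sum fun k hk => ?_) (?_ : ∑ k ∈ jumps d h δ,
        kernel d s δ ‖latticePoint h k‖ * M ≤ _)
      · exact mul_le_mul_of_nonneg_left (hM k hk) (le_trans (by positivity) (hkpos k hk))
      · rw [← Finset.sum_mul]
        exact mul_le_mul_of_nonneg_right (sum_jumps_kernel_le hD.le hh hδ0 hsum) hM0.le
    have h2 : kernelConst d s * C / (δ ^ 2 * h ^ d) * M =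
        kernelConst d s / δ ^ 2 * (C * M / h ^ d) := by field_simp
    rw [h2, mul_div_right_comm] at h1
    have h3 := le_of_mul_le_mul_left h1 (by positivity)
    rw [le_div_iff₀ (by positivity)] at h3
    rw [div_mul_eq_mul_div, div_le_iff₀ hC]
    linarith
  suffices hG : ∃ G ⊆ jumps d h δ, SatisfiesFaberKrahn d h δ G ∧ ∀ k ∈ G,
      M * (1 / (100 * d ^ 2)) ≤ α + β * ‖latticePoint h k‖ ^ 2 by
    obtain ⟨G, hGN, hFK, hlow⟩ := hG
    refine ⟨G, hGN, hFK, fun k hk => ?_⟩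
    calc kernelConst d s * v / (100 * d ^ 2 * C) * (h / δ) ^ d / δ ^ 2
        = kernelConst d s / δ ^ (d + 2) * ((v / C * h ^ d) * (1 / (100 * d ^ 2))) := by
          rw [div_pow, pow_add]
          field_simp
      _ ≤ kernelConst d s / δ ^ (d + 2) * (M * (1 / (100 * d ^ 2))) := by gcongr
      _ ≤ _ := mul_le_mul (hkpos k (hGN hk)) (hlow k hk) (by positivity)
          (le_trans (by positivity) (hkpos k (hGN hk)))
  have hsmall : 1 / (100 * (d : ℝ) ^ 2) ≤ 1 / 3 := by
    apply one_div_le_one_div_of_le (by norm_num)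
    have : (1 : ℝ) ≤ (d : ℝ) ^ 2 := one_le_pow₀ hd
    linarith
  rcases le_total δ (8 * d * h) with hδd | hδd
  · have haxis : ∀ m : ℤ, 0 < m → m * h < δ →
        (Finset.univ.image fun i : Fin d => (Pi.single i m : Fin d → ℤ)) ⊆ jumps d h δ := by
      intro m hm hmδ k hk
      obtain ⟨i, -, rfl⟩ := Finset.mem_image.1 hk
      rw [mem_jumps hh]
      refine ⟨by simp [hm.ne'], ?_⟩
      have hm' : (0 : ℝ) < m := by exact_mod_cast hm
      rw [← Real.sqrt_sq (norm_nonneg _), norm_latticePoint_single_sq,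
        Real.sqrt_sq (by positivity)]
      exact hmδ
    -- The axis jump is taken at the favourable end: the longest if the weight increases, giving a
    -- fraction at least `(g - 1) / (g + 1) ≥ 1 / 3`, and the shortest if it decreases, giving `1 -
    -- 1 / g ^ 2 ≥ 3 / 4`.
    rcases hcase with hc | hc
    · have hsub := haxis g (by omega) hgδ
      refine ⟨_, hsub, satisfiesFaberKrahn_axis hh (by linarith) hδd (by omega), fun k hk => ?_⟩
      refine le_trans ?_ (hc k (hsub hk))
      obtain ⟨i, -, rfl⟩ := Finset.mem_image.1 hk
      rw [norm_latticePoint_single_sq]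
      refine mul_le_mul_of_nonneg_left (hsmall.trans ?_) hM0.le
      rw [le_div_iff₀ (by positivity)]
      have h1 : δ ^ 2 ≤ ((g + 1) * h) ^ 2 := by gcongr
      nlinarith [mul_nonneg (sq_nonneg h) (mul_nonneg (by linarith : (0 : ℝ) ≤ g - 2)
        (by linarith : (0 : ℝ) ≤ g + 1))]
    · have hsub := haxis 1 one_pos (by push_cast; linarith)
      refine ⟨_, hsub, satisfiesFaberKrahn_axis hh (by linarith) hδd (by omega), fun k hk => ?_⟩
      refine le_trans ?_ (hc k (hsub hk))
      obtain ⟨i, -, rfl⟩ := Finset.mem_image.1 hk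
      rw [norm_latticePoint_single_sq]
      refine mul_le_mul_of_nonneg_left (hsmall.trans ?_) hM0.le
      have h1 : (((1 : ℤ) : ℝ) * h) ^ 2 / (g * h) ^ 2 ≤ 1 / 4 := by
        rw [div_le_iff₀ (by positivity)]
        push_cast
        nlinarith [mul_nonneg (sq_nonneg h) (mul_nonneg (by linarith : (0 : ℝ) ≤ g - 2)
          (by linarith : (0 : ℝ) ≤ g + 2))]
      linarith
  · set x := δ / (4 * d * h) with hx
    set n := ⌊x⌋₊ with hn
    have hx2 : 2 ≤ x := by
      rw [hx, le_div_iff₀ (by positivity)]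
      linarith
    have hnx : (n : ℝ) ≤ x := Nat.floor_le (by linarith)
    have hxn : x < n + 1 := Nat.lt_floor_add_one x
    have hn2 : 2 ≤ n := Nat.le_floor (by exact_mod_cast hx2)
    have hn2' : (2 : ℝ) ≤ n := by exact_mod_cast hn2
    have hdx : δ = 4 * d * h * x := by
      rw [hx]
      field_simp
    set G : Finset (Fin d → ℤ) := Fintype.piFinset fun _ => Finset.Icc (n : ℤ) (2 * n) with hG
    -- The cube stays away from both ends of the range, so it serves in both monotonicity cases.
    have hnorm : ∀ k ∈ G, (h * n) ^ 2 ≤ ‖latticePoint h k‖ ^ 2 ∧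
        ‖latticePoint h k‖ ^ 2 ≤ δ ^ 2 / 4 := by
      intro k hk
      have hk' : ∀ i, (n : ℝ) ≤ k i ∧ (k i : ℝ) ≤ 2 * n := by
        intro i
        have := Finset.mem_Icc.1 (Fintype.mem_piFinset.1 hk i)
        exact ⟨by exact_mod_cast this.1, by exact_mod_cast this.2⟩
      rw [norm_latticePoint_sq]
      constructor
      · rw [mul_pow]
        gcongr
        have h0 : (n : ℝ) ^ 2 ≤ (k 0 : ℝ) ^ 2 := by
          have := (hk' 0).1
          gcongr
        exact h0.trans (Finset.single_le_sum (f := fun i => (k i : ℝ) ^ 2)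
          (fun i _ => sq_nonneg _) (Finset.mem_univ 0))
      · have h1 : ∑ i, (k i : ℝ) ^ 2 ≤ ∑ _i : Fin d, (2 * x) ^ 2 := by
          refine Finset.sum_le_sum fun i _ => ?_
          have h3 := hk' i
          have h4 : (0 : ℝ) ≤ k i := by linarith [h3.1]
          have h5 : (k i : ℝ) ≤ 2 * x := by linarith [h3.2]
          gcongr
        rw [Finset.sum_const, Finset.card_univ, Fintype.card_fin, nsmul_eq_mul] at h1
        calc h ^ 2 * ∑ i, (k i : ℝ) ^ 2 ≤ h ^ 2 * (d * (2 * x) ^ 2) := by gcongr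
          _ ≤ h ^ 2 * (d ^ 2 * (2 * x) ^ 2) := by
              gcongr
              exact le_self_pow₀ hd two_ne_zero
          _ = (4 * d * h * x) ^ 2 / 4 := by ring
          _ = δ ^ 2 / 4 := by rw [← hdx]
    have hsub : G ⊆ jumps d h δ := by
      intro k hk
      obtain ⟨h1, h2⟩ := hnorm k hk
      rw [mem_jumps hh]
      constructor
      · rintro rfl
        rw [latticePoint_zero, norm_zero] at h1
        have : 0 < (h * n) ^ 2 := by positivity
        linarith
      · refine lt_of_pow_lt_pow_left₀ 2 hδ0.le ?_
        have : 0 < δ ^ 2 := by positivity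
        linarith
    refine ⟨G, hsub, satisfiesFaberKrahn_cube hh hδd, fun k hk => ?_⟩
    obtain ⟨h1, h2⟩ := hnorm k hk
    rcases hcase with hc | hc
    · refine le_trans ?_ (hc k (hsub hk))
      refine mul_le_mul_of_nonneg_left ?_ hM0.le
      have h3 : (δ / (8 * d)) ^ 2 ≤ (h * n) ^ 2 := by
        have : δ / (8 * d) ≤ h * n := by
          rw [hdx, div_le_iff₀ (by positivity)]
          have : x ≤ 2 * n := by linarith
          have h4 : 4 * d * h * x ≤ 4 * d * h * (2 * n) := by gcongr
          linarith
        gcongr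
      -- Subtracting `h ^ 2` loses at most a quarter, leaving `(3 / 4) / (64 * d ^ 2) ≥ 1 / (100 * d
      -- ^ 2)`.
      have h4 : 4 * h ^ 2 ≤ (h * n) ^ 2 := by
        have : h * 2 ≤ h * n := by gcongr
        nlinarith
      rw [div_le_div_iff₀ (by positivity) (by positivity)]
      have h5 : δ ^ 2 = 64 * d ^ 2 * (δ / (8 * d)) ^ 2 := by
        field_simp
        norm_num
      have h6 : (3 / 4) * ‖latticePoint h k‖ ^ 2 ≤ ‖latticePoint h k‖ ^ 2 - h ^ 2 := by linarith
      have h7 : (δ / (8 * d)) ^ 2 ≤ ‖latticePoint h k‖ ^ 2 := h3.trans h1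
      have hd2 : 0 < (d : ℝ) ^ 2 := by positivity
      nlinarith
    · refine le_trans ?_ (hc k (hsub hk))
      refine mul_le_mul_of_nonneg_left (hsmall.trans ?_) hM0.le
      have h3 : 7 / 8 * δ ≤ g * h := by
        have : h * 8 ≤ δ := by nlinarith
        linarith
      have h4 : ‖latticePoint h k‖ ^ 2 / (g * h) ^ 2 ≤ 1 / 2 := by
        rw [div_le_iff₀ (by positivity)]
        have : (7 / 8 * δ) ^ 2 ≤ (g * h) ^ 2 := by gcongr
        nlinarith
      linarith

end Conductance

end NonlocalMeshfree

namespace NonlocalMeshfree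

/-! ### Integrals of the kernel -/

section KernelIntegral

variable {d : ℕ}

theorem measurable_kernel_norm (s δ : ℝ) : Measurable fun z : Space d => kernel d s δ ‖z‖ := by
  unfold kernel
  refine Measurable.ite (measurableSet_lt measurable_norm measurable_const) ?_ measurable_const
  fun_prop

theorem integrableOn_ball_mul_rpow [NeZero d] {s : ℝ} (hsd : s < d) {δ : ℝ} {f : Space d → ℝ}
    {C : ℝ} (hf : Measurable f) (hC : ∀ z ∈ Metric.ball (0 : Space d) δ, |f z| ≤ C * ‖z‖ ^ (-s)) :
    IntegrableOn f (Metric.ball 0 δ) := by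
  refine integrableOn_ball_of_norm_le_rpow (C := C) (α := s) (μ := volume) ?_ ?_ ?_
    hf.aestronglyMeasurable
  · rw [finrank_euclideanSpace_fin]
    exact NeZero.one_le
  · rw [finrank_euclideanSpace_fin]
    exact hsd
  · exact (ae_restrict_iff' measurableSet_ball).2 (ae_of_all _ hC)

theorem kernelConst_pos [NeZero d] {s : ℝ} (hsd : s < d) : 0 < kernelConst d s := by
  have hd : (0 : ℝ) < d := by exact_mod_cast NeZero.pos d
  refine div_pos hd ?_
  have hint : IntegrableOn (fun z : Space d => ‖z‖ ^ 2 / ‖z‖ ^ s) (Metric.ball 0 1) := by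
    refine integrableOn_ball_mul_rpow (C := 1) hsd (by fun_prop) fun z hz => ?_
    have hz1 : ‖z‖ < 1 := by simpa using hz
    rw [abs_of_nonneg (by positivity), Real.rpow_neg (norm_nonneg _), div_eq_mul_inv]
    gcongr
    exact pow_le_one₀ (norm_nonneg _) hz1.le
  rw [setIntegral_pos_iff_support_of_nonneg_ae (ae_of_all _ fun z => by positivity) hint]
  have hsub : Metric.ball (0 : Space d) 1 \ {0} ⊆
      Function.support (fun z : Space d => ‖z‖ ^ 2 / ‖z‖ ^ s) ∩ Metric.ball 0 1 := by
    rintro z ⟨hz, hz0⟩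
    refine ⟨?_, hz⟩
    have : 0 < ‖z‖ := norm_pos_iff.2 hz0
    rw [Function.mem_support]
    positivity
  refine lt_of_lt_of_le ?_ (measure_mono hsub)
  rw [measure_sdiff_null (measure_singleton 0)]
  exact Metric.measure_ball_pos _ _ one_pos

theorem integrableOn_mul_kernel [NeZero d] {s : ℝ} (hsd : s < d) {δ : ℝ} {g : Space d → ℝ}
    (hg : Continuous g) : IntegrableOn (fun z => g z * kernel d s δ ‖z‖) (Metric.ball 0 δ) := by
  obtain ⟨B, hB⟩ := (isCompact_closedBall (0 : Space d) δ).exists_bound_of_continuousOn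
    hg.continuousOn
  refine integrableOn_ball_mul_rpow (C := B * |kernelConst d s / δ ^ ((d : ℝ) + 2 - s)|) hsd
    (hg.measurable.mul (measurable_kernel_norm s δ)) fun z hz => ?_
  have hzδ : ‖z‖ < δ := by simpa using hz
  rw [kernel, if_pos hzδ, Real.rpow_neg (norm_nonneg _), abs_mul, ← div_div, div_eq_mul_inv _
    (‖z‖ ^ s), abs_mul, abs_of_nonneg (a := (‖z‖ ^ s)⁻¹) (by positivity), mul_assoc]
  gcongr
  exact hB z (Metric.ball_subset_closedBall hz)

theorem div_sq_le_integral_kernel [NeZero d] {s : ℝ} (hs : 0 ≤ s) (hsd : s < d) {δ : ℝ}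
    (hδ : 0 < δ) : kernelConst d s * volume.real (Metric.ball (0 : Space d) 1) / δ ^ 2 ≤
      ∫ z in Metric.ball (0 : Space d) δ, kernel d s δ ‖z‖ := by
  have hD := kernelConst_pos hsd
  have h1 : ∫ _z in Metric.ball (0 : Space d) δ, kernelConst d s / δ ^ (d + 2) ≤
      ∫ z in Metric.ball (0 : Space d) δ, kernel d s δ ‖z‖ := by
    refine setIntegral_mono_ae_restrict (integrableOn_const measure_ball_lt_top.ne)
      (by simpa using integrableOn_mul_kernel hsd (continuous_const (y := (1 : ℝ)))) ?_
    have h0 : ∀ᵐ z : Space d, z ≠ 0 := by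
      rw [ae_iff]
      simp
    filter_upwards [ae_restrict_of_ae h0, ae_restrict_mem measurableSet_ball] with z hz hzb
    exact div_pow_le_kernel hs hD.le (norm_pos_iff.2 hz) (by simpa using hzb)
  refine le_trans (le_of_eq ?_) h1
  rw [setIntegral_const, smul_eq_mul, measureReal_def, measureReal_def,
    Measure.addHaar_ball volume (0 : Space d) hδ.le, finrank_euclideanSpace_fin,
    ENNReal.toReal_mul, ENNReal.toReal_ofReal (by positivity), pow_add]
  field_simp

end KernelIntegral

/-! ### Lattice symmetries and exactness on cubic polynomials -/

section Symmetry

variable {d : ℕ}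

/-- The difference between the quadrature with weights `ψ` and the integral of `g` against the
kernel on the ball of radius `δ`. -/
noncomputable def quadratureDefect (s h δ : ℝ) (ψ : ℝ → ℝ) (g : Space d → ℝ) : ℝ :=
  ∑ k ∈ jumps d h δ, g (latticePoint h k) * kernel d s δ ‖latticePoint h k‖ *
      ψ ‖latticePoint h k‖ -
    ∫ z in Metric.ball (0 : Space d) δ, g z * kernel d s δ ‖z‖

theorem quadratureDefect_sum_mul [NeZero d] {s : ℝ} (hsd : s < d) (h δ : ℝ) (ψ : ℝ → ℝ)
    {ι : Type*} (S : Finset ι) (c : ι → ℝ) (g : ι → Space d → ℝ) (hg : ∀ i ∈ S, Continuous (g i)) :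
    quadratureDefect s h δ ψ (fun z => ∑ i ∈ S, c i * g i z) =
      ∑ i ∈ S, c i * quadratureDefect s h δ ψ (g i) := by
  have h1 : ∫ z in Metric.ball (0 : Space d) δ, (∑ i ∈ S, c i * g i z) * kernel d s δ ‖z‖ =
      ∑ i ∈ S, c i * ∫ z in Metric.ball (0 : Space d) δ, g i z * kernel d s δ ‖z‖ := by
    simp only [Finset.sum_mul, mul_assoc]
    rw [integral_finsetSum _ fun i hi =>
      (integrableOn_mul_kernel hsd (hg i hi)).const_mul (c i)]
    exact Finset.sum_congr rfl fun i _ => integral_const_mul _ _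
  simp only [quadratureDefect]
  rw [h1]
  simp only [mul_sub, Finset.sum_sub_distrib, Finset.sum_mul, Finset.mul_sum]
  rw [Finset.sum_comm]
  simp only [mul_assoc]

/-- An isometry permuting the lattice preserves the jumps, the radial weights and Lebesgue measure
on the ball. -/
theorem quadratureDefect_comp {s h δ : ℝ} (hh : 0 < h) (ψ : ℝ → ℝ)
    (T : Space d ≃ₗᵢ[ℝ] Space d) (τ : (Fin d → ℤ) → (Fin d → ℤ))
    (hT : ∀ k, latticePoint h (τ k) = T (latticePoint h k)) (hτ : ∀ k, τ (τ k) = k)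
    (g : Space d → ℝ) :
    quadratureDefect s h δ ψ (fun z => g (T z)) = quadratureDefect s h δ ψ g := by
  have hnorm : ∀ k, ‖latticePoint h (τ k)‖ = ‖latticePoint h k‖ := fun k => by
    rw [hT, LinearIsometryEquiv.norm_map]
  have hmem : ∀ k ∈ jumps d h δ, τ k ∈ jumps d h δ := by
    intro k hk
    rw [mem_jumps hh] at hk ⊢
    rw [hnorm]
    refine ⟨fun h0 => ?_, hk.2⟩
    have := norm_latticePoint_pos hh hk.1
    rw [← hnorm, h0, latticePoint_zero, norm_zero] at this
    exact this.false
  simp only [quadratureDefect]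
  congr 1
  · refine Finset.sum_nbij' τ τ hmem hmem (fun k _ => hτ k) (fun k _ => hτ k) fun k _ => ?_
    rw [hnorm, hT]
  · have h1 := (T.measurePreserving).setIntegral_preimage_emb
      T.toHomeomorph.measurableEmbedding (fun z => g z * kernel d s δ ‖z‖) (Metric.ball 0 δ)
    have h2 : T ⁻¹' Metric.ball (0 : Space d) δ = Metric.ball 0 δ := by
      ext z
      simp
    rw [h2] at h1
    simpa using h1

/-- The reflection of the `i`-th coordinate. -/
noncomputable def reflectCoord (i : Fin d) : Space d ≃ₗᵢ[ℝ] Space d :=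
  LinearIsometryEquiv.piLpCongrRight 2 fun j =>
    if j = i then LinearIsometryEquiv.neg ℝ else LinearIsometryEquiv.refl ℝ ℝ

theorem reflectCoord_apply (i : Fin d) (z : Space d) (j : Fin d) :
    reflectCoord i z j = if j = i then -z j else z j := by
  simp only [reflectCoord, LinearIsometryEquiv.piLpCongrRight_apply]
  split_ifs <;> simp

/-- The exchange of the coordinates `i` and `j`. -/
noncomputable def swapCoord (i j : Fin d) : Space d ≃ₗᵢ[ℝ] Space d :=
  LinearIsometryEquiv.piLpCongrLeft 2 ℝ ℝ (Equiv.swap i j)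

theorem swapCoord_apply (i j : Fin d) (z : Space d) (l : Fin d) :
    swapCoord i j z l = z (Equiv.swap i j l) := by
  simp [swapCoord, LinearIsometryEquiv.piLpCongrLeft_apply, Equiv.piCongrLeft'_apply]

theorem quadratureDefect_monomial_of_odd {s h δ : ℝ} (hh : 0 < h) (ψ : ℝ → ℝ) (m : Fin d → ℕ)
    {i : Fin d} (hi : Odd (m i)) :
    quadratureDefect s h δ ψ (fun z : Space d => ∏ j, z j ^ m j) = 0 := by
  have h1 := quadratureDefect_comp (s := s) (δ := δ) hh ψ (reflectCoord i)
    (fun k j => if j = i then -k j else k j)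
    (fun k => by
      ext j
      rw [reflectCoord_apply, latticePoint_apply, latticePoint_apply]
      split_ifs <;> simp)
    (fun k => by
      ext j
      split_ifs <;> simp_all)
    (fun z => ∏ j, z j ^ m j)
  have h2 : ∀ z : Space d, ∏ j, reflectCoord i z j ^ m j = -∏ j, z j ^ m j := by
    intro z
    rw [← Finset.mul_prod_erase _ _ (Finset.mem_univ i),
      ← Finset.mul_prod_erase _ (fun j => z j ^ m j) (Finset.mem_univ i), reflectCoord_apply,
      if_pos rfl, hi.neg_pow, neg_mul]
    congr 2
    refine Finset.prod_congr rfl fun j hj => ?_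
    rw [reflectCoord_apply, if_neg (Finset.ne_of_mem_erase hj)]
  simp only [h2] at h1
  have h3 : quadratureDefect s h δ ψ (fun z : Space d => -∏ j, z j ^ m j) =
      -quadratureDefect s h δ ψ (fun z : Space d => ∏ j, z j ^ m j) := by
    simp only [quadratureDefect, neg_mul, Finset.sum_neg_distrib, integral_neg]
    ring
  rw [h3] at h1
  linarith

/-- Exchanging coordinates makes the defects of all the squares equal, and they add up to the defect
of `|z|²`. -/
theorem quadratureDefect_sq_coord [NeZero d] {s h δ : ℝ} (hsd : s < d) (hh : 0 < h) (ψ : ℝ → ℝ)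
    (hψ : quadratureDefect s h δ ψ (fun z : Space d => ‖z‖ ^ 2) = 0) (i : Fin d) :
    quadratureDefect s h δ ψ (fun z : Space d => z i ^ 2) = 0 := by
  have h1 : ∀ j, quadratureDefect s h δ ψ (fun z : Space d => z j ^ 2) =
      quadratureDefect s h δ ψ (fun z : Space d => z i ^ 2) := by
    intro j
    have := quadratureDefect_comp (s := s) (δ := δ) hh ψ (swapCoord i j)
      (fun k l => k (Equiv.swap i j l))
      (fun k => by
        ext l
        rw [swapCoord_apply, latticePoint_apply, latticePoint_apply])
      (fun k => by
        ext l
        simp)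
      (fun z => z i ^ 2)
    simpa [swapCoord_apply] using this
  have h2 := quadratureDefect_sum_mul hsd h δ ψ Finset.univ (fun _ => 1)
    (fun (j : Fin d) (z : Space d) => z j ^ 2) (fun j _ => by fun_prop)
  have h3 : (fun z : Space d => ‖z‖ ^ 2) = fun z => ∑ j, 1 * z j ^ 2 := by
    ext z
    simp [EuclideanSpace.norm_sq_eq]
  rw [← h3, hψ] at h2
  simp only [h1, one_mul, Finset.sum_const, Finset.card_univ, Fintype.card_fin,
    nsmul_eq_mul] at h2
  have hd : (d : ℝ) ≠ 0 := by exact_mod_cast NeZero.ne d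
  exact (mul_eq_zero.1 h2.symm).resolve_left hd

/-- Radial weights that reproduce `1` and `|z|²` reproduce all polynomials of degree at most
three. -/
theorem quadratureDefect_polynomial [NeZero d] {s h δ : ℝ} (hsd : s < d) (hh : 0 < h) (ψ : ℝ → ℝ)
    (h0 : quadratureDefect s h δ ψ (fun _ : Space d => 1) = 0)
    (h2 : quadratureDefect s h δ ψ (fun z : Space d => ‖z‖ ^ 2) = 0)
    {p : MvPolynomial (Fin d) ℝ} (hp : p.totalDegree ≤ 3) :
    quadratureDefect s h δ ψ (fun z : Space d => MvPolynomial.eval (fun i => z i) p) = 0 := by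
  simp only [MvPolynomial.eval_eq']
  rw [quadratureDefect_sum_mul hsd h δ ψ p.support (fun m => p.coeff m)
    (fun m (z : Space d) => ∏ i, z i ^ m i) (fun m _ => by fun_prop)]
  refine Finset.sum_eq_zero fun m hm => mul_eq_zero_of_right _ ?_
  have hdeg : ∑ i, m i ≤ 3 := by
    have := (MvPolynomial.le_totalDegree hm).trans hp
    rwa [Finsupp.sum_fintype _ _ fun _ => rfl] at this
  by_cases hodd : ∃ i, Odd (m i)
  · obtain ⟨i, hi⟩ := hodd
    exact quadratureDefect_monomial_of_odd hh ψ m hi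
  -- Even exponents of total degree at most three leave only the constant or the square of a single
  -- coordinate.
  · simp only [not_exists, Nat.not_odd_iff_even] at hodd
    by_cases hm0 : ∃ i, m i ≠ 0
    · obtain ⟨i, hi⟩ := hm0
      have hsum : m i + ∑ j ∈ Finset.univ.erase i, m j = ∑ j, m j :=
        Finset.add_sum_erase _ _ (Finset.mem_univ i)
      have hi2 : 2 ≤ m i := by
        obtain ⟨c, hc⟩ := hodd i
        omega
      have hother : ∀ j, j ≠ i → m j = 0 := by
        intro j hj
        have : m j ≤ ∑ j ∈ Finset.univ.erase i, m j :=
          Finset.single_le_sum (f := fun j => m j) (fun _ _ => Nat.zero_le _)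
            (Finset.mem_erase.2 ⟨hj, Finset.mem_univ j⟩)
        obtain ⟨c, hc⟩ := hodd j
        omega
      have hmi : m i = 2 := by
        obtain ⟨c, hc⟩ := hodd i
        omega
      have : (fun z : Space d => ∏ j, z j ^ m j) = fun z => z i ^ 2 := by
        ext z
        rw [Finset.prod_eq_single i (fun j _ hj => by rw [hother j hj, pow_zero]) (by simp), hmi]
      rw [this]
      exact quadratureDefect_sq_coord hsd hh ψ h2 i
    · push Not at hm0
      simpa [hm0] using h0

end Symmetry

end NonlocalMeshfree

namespace NonlocalMeshfree

/-! ### Identification of the quadrature weights -/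

section Weights

variable {d : ℕ}

/-- If `δ ≤ 2h`, all neighbours of the origin have first coordinate `-h`, `0` or `h`, and the
nonzero cubic `X³ - h²X` vanishes on them. -/
theorem two_mul_lt_of_isUnisolvent [NeZero d] {h δ : ℝ} (hh : 0 < h)
    (hu : IsUnisolvent (lattice d h) δ (0 : Space d)) : 2 * h < δ := by
  by_contra! hδ
  let p : MvPolynomial (Fin d) ℝ :=
    MvPolynomial.X 0 ^ 3 - MvPolynomial.C (h ^ 2) * MvPolynomial.X 0
  have hdeg : p.totalDegree ≤ 3 := by
    refine (MvPolynomial.totalDegree_sub _ _).trans (max_le ?_ ?_)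
    · exact (MvPolynomial.totalDegree_pow _ _).trans (by simp)
    · refine (MvPolynomial.totalDegree_mul _ _).trans ?_
      rw [MvPolynomial.totalDegree_C, MvPolynomial.totalDegree_X]
      norm_num
  have hp := hu p hdeg fun y hy => by
    obtain ⟨⟨hyl, hyb⟩, -⟩ := hy
    obtain ⟨k, rfl⟩ := mem_lattice_iff.1 hyl
    have h1 : ‖latticePoint h k‖ < 2 * h := (by simpa using hyb : _ < δ).trans_le hδ
    rw [norm_latticePoint_eq_mul hh, mul_comm] at h1
    have h2 := (abs_le_norm_latticePoint_one k 0).trans_lt (lt_of_mul_lt_mul_right h1 hh.le)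
    have h3 : |k 0| < 2 := by exact_mod_cast h2
    rw [abs_lt] at h3
    simp only [p, map_sub, map_mul, map_pow, MvPolynomial.eval_X, MvPolynomial.eval_C,
      latticePoint_apply, PiLp.zero_apply, sub_zero]
    have h4 : k 0 = -1 ∨ k 0 = 0 ∨ k 0 = 1 := by omega
    rcases h4 with h4 | h4 | h4 <;> rw [h4] <;> push_cast <;> ring
  have h5 := congrArg (MvPolynomial.eval fun _ => 2 * h) hp
  simp only [p, map_sub, map_mul, map_pow, MvPolynomial.eval_X, MvPolynomial.eval_C, map_zero] at h5
  have : 0 < h ^ 3 := by positivity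
  nlinarith

theorem neighbors_lattice {h δ : ℝ} (hh : 0 < h) {x : Space d} (hx : x ∈ lattice d h) :
    neighbors (lattice d h) δ x = (fun k => x + latticePoint h k) '' ↑(jumps d h δ) := by
  obtain ⟨l, rfl⟩ := mem_lattice_iff.1 hx
  ext y
  constructor
  · rintro ⟨⟨hy, hyb⟩, hne⟩
    obtain ⟨m, rfl⟩ := mem_lattice_iff.1 hy
    have e : latticePoint h l + latticePoint h (m - l) = latticePoint h m := by
      rw [← latticePoint_add, add_sub_cancel]
    refine ⟨m - l, Finset.mem_coe.2 ((mem_jumps hh).2 ⟨fun h0 => hne ?_, ?_⟩), e⟩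
    · rw [sub_eq_zero] at h0
      rw [h0]
      rfl
    · rw [Metric.mem_ball, dist_eq_norm, ← e, add_sub_cancel_left] at hyb
      exact hyb
  · rintro ⟨k, hk, rfl⟩
    obtain ⟨hk0, hkδ⟩ := (mem_jumps hh).1 (Finset.mem_coe.1 hk)
    refine ⟨⟨mem_lattice_iff.2 ⟨l + k, latticePoint_add _ _ _⟩, by simpa using hkδ⟩, fun h0 => ?_⟩
    have h1 : latticePoint h k = 0 := by simpa using h0
    have := norm_latticePoint_pos hh hk0
    rw [h1, norm_zero] at this
    exact this.false

theorem finsum_mem_neighbors_lattice {h δ : ℝ} (hh : 0 < h) {x : Space d} (hx : x ∈ lattice d h)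
    (f : Space d → ℝ) : ∑ᶠ y ∈ neighbors (lattice d h) δ x, f y =
      ∑ k ∈ jumps d h δ, f (x + latticePoint h k) := by
  rw [neighbors_lattice hh hx, finsum_mem_image, finsum_mem_coe_finset]
  exact fun a _ b _ hab => latticePoint_injective hh (add_left_cancel hab)

theorem isExact_lattice_iff {s h δ : ℝ} (hh : 0 < h) {x : Space d} (hx : x ∈ lattice d h)
    (w : Space d → ℝ) : IsExact s (lattice d h) δ x w ↔
      ∀ p : MvPolynomial (Fin d) ℝ, p.totalDegree ≤ 3 →
        ∑ k ∈ jumps d h δ, MvPolynomial.eval (fun i => latticePoint h k i) p *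
          kernel d s δ ‖latticePoint h k‖ * w (x + latticePoint h k) =
        ∫ z in Metric.ball (0 : Space d) δ,
          MvPolynomial.eval (fun i => z i) p * kernel d s δ ‖z‖ := by
  have hint : ∀ q : Space d → ℝ, ∫ y in Metric.ball x δ, q y =
      ∫ z in Metric.ball (0 : Space d) δ, q (x + z) := by
    intro q
    have h1 := (measurePreserving_add_left volume x).setIntegral_preimage_emb
      (measurableEmbedding_addLeft x) q (Metric.ball x δ)
    have h2 : (fun z => x + z) ⁻¹' Metric.ball x δ = Metric.ball 0 δ := by
      ext z
      simp
    rw [h2] at h1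
    exact h1.symm
  constructor
  · intro hw p hp
    have := hw (fun y => MvPolynomial.eval (fun i => y i - x i) p * kernel d s δ ‖x - y‖)
      ⟨p, hp, fun y => rfl⟩
    rw [finsum_mem_neighbors_lattice hh hx, hint] at this
    simpa using this
  · rintro hw q ⟨p, hp, hq⟩
    rw [finsum_mem_neighbors_lattice hh hx, hint]
    simpa [hq] using hw p hp

/-- A radial quadratic weight that reproduces `1` and `|z|²`. -/
theorem exists_radialWeight [NeZero d] {s h δ : ℝ} (hs : 0 ≤ s) (hsd : s < d) (hh : 0 < h)
    (hδ : 2 * h < δ) : ∃ α β : ℝ,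
      quadratureDefect s h δ (fun t => α + β * t ^ 2) (fun _ : Space d => 1) = 0 ∧
      quadratureDefect s h δ (fun t => α + β * t ^ 2) (fun z : Space d => ‖z‖ ^ 2) = 0 := by
  have hD := kernelConst_pos hsd
  set γ : (Fin d → ℤ) → ℝ := fun k => kernel d s δ ‖latticePoint h k‖ with hγ
  set ρ : (Fin d → ℤ) → ℝ := fun k => ‖latticePoint h k‖ ^ 2 with hρ
  set S₀ := ∑ k ∈ jumps d h δ, γ k with hS₀
  set S₁ := ∑ k ∈ jumps d h δ, γ k * ρ k with hS₁
  set S₂ := ∑ k ∈ jumps d h δ, γ k * ρ k ^ 2 with hS₂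
  have hγpos : ∀ k ∈ jumps d h δ, 0 < γ k := fun k hk => by
    obtain ⟨hk0, hkδ⟩ := (mem_jumps hh).1 hk
    have hδ0 : 0 < δ := by linarith
    exact lt_of_lt_of_le (by positivity) (div_pow_le_kernel hs hD.le
      (norm_latticePoint_pos hh hk0) hkδ)
  have hsingle : ∀ m : ℤ, 0 < m → m * h < δ → Pi.single (0 : Fin d) m ∈ jumps d h δ := by
    intro m hm hmδ
    rw [mem_jumps hh]
    refine ⟨by simp [hm.ne'], ?_⟩
    have hm' : (0 : ℝ) < m := by exact_mod_cast hm
    rw [← Real.sqrt_sq (norm_nonneg _), norm_latticePoint_single_sq,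
      Real.sqrt_sq (by positivity)]
    exact hmδ
  have h1 := hsingle 1 one_pos (by push_cast; linarith)
  have h2 := hsingle 2 two_pos (by push_cast; linarith)
  have hS₀pos : 0 < S₀ := Finset.sum_pos hγpos ⟨_, h1⟩
  -- The Gram determinant is `S₀` times the kernel-weighted sum of squared deviations of `|z|²` from
  -- its mean. It is positive because jumps of lengths `h` and `2h` both occur.
  have hdet : 0 < S₀ * S₂ - S₁ ^ 2 := by
    set m := S₁ / S₀ with hm
    have e : ∑ k ∈ jumps d h δ, γ k * (ρ k - m) ^ 2 = S₂ - 2 * m * S₁ + m ^ 2 * S₀ := by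
      rw [hS₀, hS₁, hS₂, Finset.mul_sum, Finset.mul_sum, ← Finset.sum_sub_distrib,
        ← Finset.sum_add_distrib]
      exact Finset.sum_congr rfl fun k _ => by ring
    have hpos : 0 < ∑ k ∈ jumps d h δ, γ k * (ρ k - m) ^ 2 := by
      have hnn : ∀ k ∈ jumps d h δ, 0 ≤ γ k * (ρ k - m) ^ 2 := fun k hk =>
        mul_nonneg (hγpos k hk).le (sq_nonneg _)
      refine (Finset.sum_nonneg hnn).lt_of_ne fun h0 => ?_
      have h3 := (Finset.sum_eq_zero_iff_of_nonneg hnn).1 h0.symm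
      have h4 : ∀ k ∈ jumps d h δ, ρ k = m := fun k hk => by
        have := (mul_eq_zero.1 (h3 k hk)).resolve_left (hγpos k hk).ne'
        exact sub_eq_zero.1 (pow_eq_zero_iff two_ne_zero |>.1 this)
      have h5 := (h4 _ h1).trans (h4 _ h2).symm
      simp only [hρ, norm_latticePoint_single_sq] at h5
      push_cast at h5
      nlinarith [mul_pos hh hh]
    have h6 : S₀ * (S₂ - 2 * m * S₁ + m ^ 2 * S₀) = S₀ * S₂ - S₁ ^ 2 := by
      rw [hm]
      field_simp
      ring
    rw [← h6, ← e]
    positivity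
  set I₀ := ∫ z in Metric.ball (0 : Space d) δ, (1 : ℝ) * kernel d s δ ‖z‖
  set I₁ := ∫ z in Metric.ball (0 : Space d) δ, ‖z‖ ^ 2 * kernel d s δ ‖z‖
  refine ⟨(I₀ * S₂ - I₁ * S₁) / (S₀ * S₂ - S₁ ^ 2), (S₀ * I₁ - S₁ * I₀) / (S₀ * S₂ - S₁ ^ 2),
    ?_, ?_⟩
  · have e : ∀ α β : ℝ, ∑ k ∈ jumps d h δ, 1 * kernel d s δ ‖latticePoint h k‖ *
        (α + β * ‖latticePoint h k‖ ^ 2) = α * S₀ + β * S₁ := fun α β => by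
      rw [hS₀, hS₁, Finset.mul_sum, Finset.mul_sum, ← Finset.sum_add_distrib]
      exact Finset.sum_congr rfl fun k _ => by simp only [hγ, hρ]; ring
    simp only [quadratureDefect]
    rw [e, sub_eq_zero]
    change _ = I₀
    rw [div_mul_eq_mul_div, div_mul_eq_mul_div, ← add_div, div_eq_iff hdet.ne']
    ring
  · have e : ∀ α β : ℝ, ∑ k ∈ jumps d h δ, ‖latticePoint h k‖ ^ 2 *
        kernel d s δ ‖latticePoint h k‖ * (α + β * ‖latticePoint h k‖ ^ 2) =
        α * S₁ + β * S₂ := fun α β => by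
      rw [hS₁, hS₂, Finset.mul_sum, Finset.mul_sum, ← Finset.sum_add_distrib]
      exact Finset.sum_congr rfl fun k _ => by simp only [hγ, hρ]; ring
    simp only [quadratureDefect]
    rw [e, sub_eq_zero]
    change _ = I₁
    rw [div_mul_eq_mul_div, div_mul_eq_mul_div, ← add_div, div_eq_iff hdet.ne']
    ring

/-- On full lattice balls the quadrature weights are the same radial quadratic function at every
point. -/
theorem exists_eq_radialWeight [NeZero d] {s h δ : ℝ} (hs : 0 ≤ s) (hsd : s < d) (hh : 0 < h)
    (hδ : 2 * h < δ) : ∃ α β : ℝ,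
      ∑ k ∈ jumps d h δ, kernel d s δ ‖latticePoint h k‖ * (α + β * ‖latticePoint h k‖ ^ 2) =
        ∫ z in Metric.ball (0 : Space d) δ, kernel d s δ ‖z‖ ∧
      ∀ x ∈ lattice d h, ∀ w, IsQuadratureWeight s (lattice d h) δ x w →
        ∀ k ∈ jumps d h δ, w (x + latticePoint h k) = α + β * ‖latticePoint h k‖ ^ 2 := by
  have hD := kernelConst_pos hsd
  have hδ0 : 0 < δ := by linarith
  obtain ⟨α, β, h0, h2⟩ := exists_radialWeight (d := d) hs hsd hh hδ
  refine ⟨α, β, ?_, fun x hx w hw => ?_⟩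
  · simp only [quadratureDefect, one_mul] at h0
    exact sub_eq_zero.1 h0
  set ψ : (Fin d → ℤ) → ℝ := fun k => α + β * ‖latticePoint h k‖ ^ 2 with hψ
  have hγpos : ∀ k ∈ jumps d h δ, 0 < kernel d s δ ‖latticePoint h k‖ := fun k hk => by
    obtain ⟨hk0, hkδ⟩ := (mem_jumps hh).1 hk
    exact lt_of_lt_of_le (by positivity) (div_pow_le_kernel hs hD.le
      (norm_latticePoint_pos hh hk0) hkδ)
  have hexact : IsExact s (lattice d h) δ x fun y => α + β * ‖y - x‖ ^ 2 := by
    rw [isExact_lattice_iff hh hx]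
    intro p hp
    have := quadratureDefect_polynomial hsd hh _ h0 h2 hp
    simp only [quadratureDefect] at this
    simpa only [add_sub_cancel_left] using sub_eq_zero.1 this
  have hobj := hw.2 _ hexact
  rw [objective, objective, finsum_mem_neighbors_lattice hh hx,
    finsum_mem_neighbors_lattice hh hx] at hobj
  simp only [add_sub_cancel_left] at hobj
  -- The radial weight is itself an admissible test polynomial. Exactness of both weights against it
  -- makes `w - ψ` orthogonal to `ψ`, so the weighted square of `w - ψ` is twice the gap of
  -- objectives, which optimality of `w` makes nonpositive.
  let p : MvPolynomial (Fin d) ℝ :=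
    MvPolynomial.C α + MvPolynomial.C β * ∑ i, MvPolynomial.X i ^ 2
  have hp : p.totalDegree ≤ 3 := by
    refine (MvPolynomial.totalDegree_add _ _).trans (max_le (by simp) ?_)
    refine (MvPolynomial.totalDegree_mul _ _).trans ?_
    rw [MvPolynomial.totalDegree_C, zero_add]
    refine MvPolynomial.totalDegree_finsetSum_le fun i _ => ?_
    exact (MvPolynomial.totalDegree_pow _ _).trans (by simp)
  have hpe : ∀ k, MvPolynomial.eval (fun i => latticePoint h k i) p = ψ k := by
    intro k
    simp [p, hψ, EuclideanSpace.norm_sq_eq, mul_pow]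
  have e1 := (isExact_lattice_iff hh hx _).1 hw.1 p hp
  have e2 := (isExact_lattice_iff hh hx _).1 hexact p hp
  rw [← e2] at e1
  simp only [hpe, add_sub_cancel_left] at e1
  have hnn : ∀ k ∈ jumps d h δ,
      0 ≤ kernel d s δ ‖latticePoint h k‖ * (w (x + latticePoint h k) - ψ k) ^ 2 := fun k hk =>
    mul_nonneg (hγpos k hk).le (sq_nonneg _)
  have hle : ∑ k ∈ jumps d h δ,
      kernel d s δ ‖latticePoint h k‖ * (w (x + latticePoint h k) - ψ k) ^ 2 ≤ 0 := by
    have e3 : ∑ k ∈ jumps d h δ,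
        kernel d s δ ‖latticePoint h k‖ * (w (x + latticePoint h k) - ψ k) ^ 2 =
        2 * (∑ k ∈ jumps d h δ,
          w (x + latticePoint h k) ^ 2 * kernel d s δ ‖latticePoint h k‖ / 2 -
        ∑ k ∈ jumps d h δ, ψ k ^ 2 * kernel d s δ ‖latticePoint h k‖ / 2) -
        2 * (∑ k ∈ jumps d h δ,
          ψ k * kernel d s δ ‖latticePoint h k‖ * w (x + latticePoint h k) -
        ∑ k ∈ jumps d h δ, ψ k * kernel d s δ ‖latticePoint h k‖ * ψ k) := by
      rw [← Finset.sum_sub_distrib, ← Finset.sum_sub_distrib, Finset.mul_sum, Finset.mul_sum,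
        ← Finset.sum_sub_distrib]
      exact Finset.sum_congr rfl fun k _ => by ring
    rw [e3, e1]
    linarith
  intro k hk
  have h3 := (Finset.sum_eq_zero_iff_of_nonneg hnn).1
    (le_antisymm hle (Finset.sum_nonneg hnn)) k hk
  have h4 := (mul_eq_zero.1 h3).resolve_left (hγpos k hk).ne'
  exact sub_eq_zero.1 (pow_eq_zero_iff two_ne_zero |>.1 h4)

end Weights

end NonlocalMeshfree

namespace NonlocalMeshfree

/-! ### The uniform bound and its transfer to the grid -/

section MaximumBound

variable {d : ℕ}

/-- Uniform bound for subsolutions of a symmetric lattice equation whose conductances are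
comparable to the kernel times a positive radial quadratic weight. -/
theorem exists_bound_of_conductance [NeZero d] {s r v C ℓ : ℝ} (hs : 0 ≤ s)
    (hD : 0 < kernelConst d s) (hv : 0 < v) (hC : 0 < C) (hr : 0 < r) (hℓ : 0 < ℓ) :
    ∃ κ : ℝ, 0 < κ ∧ ∀ h δ α β : ℝ, 0 < h → 2 * h < δ → δ ≤ 1 →
      (∀ k ∈ jumps d h δ, 0 < α + β * ‖latticePoint h k‖ ^ 2) →
      ∑ k ∈ jumps d h δ, (‖latticePoint h k‖ ^ s)⁻¹ ≤ C * (δ ^ d / (h ^ d * δ ^ s)) →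
      kernelConst d s * v / δ ^ 2 ≤ ∑ k ∈ jumps d h δ,
        kernel d s δ ‖latticePoint h k‖ * (α + β * ‖latticePoint h k‖ ^ 2) →
      ∀ (P : Finset (Fin d → ℤ)) (Q : Set (Fin d → ℤ)), ↑P ⊆ Q →
      (∀ x ∈ P, ∀ z ∈ jumps d h δ, x + z ∈ Q) → (P.card : ℝ) ≤ (ℓ / h) ^ d →
      ∀ a : (Fin d → ℤ) → (Fin d → ℤ) → ℝ, (∀ x ∈ Q, ∀ y ∈ Q, a x y = a y x) →
      (∀ x ∈ Q, ∀ z ∈ jumps d h δ, x + z ∈ Q →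
        r * (kernel d s δ ‖latticePoint h z‖ * (α + β * ‖latticePoint h z‖ ^ 2)) ≤ a x (x + z)) →
      ∀ (u : (Fin d → ℤ) → ℝ) (F : ℝ), 0 < F → (∀ x ∈ Q, x ∉ P → u x ≤ 0) →
      (∀ x ∈ P, ∑ z ∈ jumps d h δ, a x (x + z) * (u x - u (x + z)) ≤ F) →
      ∀ x ∈ P, u x ≤ κ * F := by
  have hd : (0 : ℝ) < d := by exact_mod_cast NeZero.pos d
  set c := kernelConst d s * v / (100 * d ^ 2 * C) with hc
  have hc0 : 0 < c := by positivity
  set b : ℝ := 324 * d ^ 3 * (8 * d) ^ (d + 2) with hb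
  have hb0 : 0 < b := by positivity
  -- The first term is the final level of the Stampacchia iteration, the second the gain from one
  -- jump.
  refine ⟨4 / 3 * (2 ^ (d + 1) * (b / c) / r * ℓ ^ 2) + (16 * d) ^ d / (r * c), by positivity, ?_⟩
  intro h δ α β hh hδ hδ1 hpos hsum hmass P Q hPQ hQ hP a hsymm ha u F hF hu heq
  have hδ0 : 0 < δ := by linarith
  obtain ⟨G, hGN, ⟨hGc, hFK⟩, hGlow⟩ :=
    exists_jumps_satisfiesFaberKrahn hs hD hv hC hh hδ hpos hsum hmass
  rw [← hc] at hGlow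
  rw [← hb] at hFK
  set w : (Fin d → ℤ) → ℝ := fun k =>
    kernel d s δ ‖latticePoint h k‖ * (α + β * ‖latticePoint h k‖ ^ 2) with hw
  have hw0 : ∀ k ∈ jumps d h δ, 0 ≤ w k := fun k hk => by
    obtain ⟨hk0, hkδ⟩ := (mem_jumps hh).1 hk
    exact mul_nonneg (le_trans (by positivity) (div_pow_le_kernel hs hD.le
      (norm_latticePoint_pos hh hk0) hkδ)) (hpos k hk).le
  set q := c * (h / δ) ^ d / δ ^ 2 with hq
  have hq0 : 0 < q := by positivity
  set ρ := δ / (16 * d * h) with hρ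
  have hρ0 : 0 < ρ := by positivity
  have hEG : ∀ φ : (Fin d → ℤ) → ℝ, q * ∑ z ∈ G, translationEnergy φ z ≤
      ∑ z ∈ jumps d h δ, w z * translationEnergy φ z := fun φ => by
    rw [Finset.mul_sum]
    refine le_trans (Finset.sum_le_sum fun z hz => mul_le_mul_of_nonneg_right (hGlow z hz)
      (translationEnergy_nonneg φ z)) (Finset.sum_le_sum_of_subset_of_nonneg hGN fun z hz _ =>
        mul_nonneg (hw0 z hz) (translationEnergy_nonneg φ z))
  -- Lengths are in mesh units, so the factor `h ^ 2` in `B` cancels against `L ^ 2 = (ℓ / h) ^ 2`.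
  obtain ⟨t, ht0, htle, htc⟩ := exists_card_superlevel_le (P := P) (v := u) (d := d)
    (B := b / c * h ^ 2) (F := F) (r := r) (L := ℓ / h) (ρ := ρ) hr (by positivity) hF
    (by positivity) hρ0 (fun t => ∑ z ∈ jumps d h δ, w z * translationEnergy (truncation P u t) z)
    hP
    (fun t l _ hρl hcard => by
      have hl : 0 < l := hρ0.trans_le hρl
      refine (hFK _ (truncation_nonneg P u t) _ (support_truncation_subset P u t) l hρl
        hcard).trans ?_
      have e : b * l ^ 2 * (h / δ) ^ (d + 2) = b / c * h ^ 2 * l ^ 2 * q := by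
        rw [hq, pow_add, div_pow h δ 2]
        field_simp
      rw [e, mul_assoc]
      exact mul_le_mul_of_nonneg_left (hEG _) (by positivity))
    (fun t ht => sum_mul_translationEnergy_truncation_le hPQ (fun z hz => neg_mem_jumps hh hz) hQ
      hsymm (fun z hz => mul_nonneg hr.le (hw0 z hz)) ha hu heq ht)
  have hGpos : (0 : ℝ) < G.card := lt_of_lt_of_le (by positivity) hGc
  have hGne : G.Nonempty := Finset.card_pos.1 (by exact_mod_cast hGpos)
  have h2S : 2 * (superlevel P u t).card ≤ G.card := by
    have : 2 * ((superlevel P u t).card : ℝ) ≤ G.card := by linarith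
    exact_mod_cast this
  intro x hx
  have hfin := le_of_card_superlevel_le hPQ hQ hGN hr hq0 hw0 hGlow ha hu heq ht0 hF.le hGne h2S x hx
  refine hfin.trans ?_
  rw [add_mul]
  refine add_le_add (htle.trans (le_of_eq ?_)) ?_
  · field_simp
  -- The bound `2 * ρ ^ d ≤ G.card` cancels the factor `(h / δ) ^ d` in `q`, leaving `δ ^ 2 ≤ 1`.
  · calc 2 * F / (r * q * G.card) ≤ 2 * F / (r * q * (2 * ρ ^ d)) := by gcongr
      _ = δ ^ 2 * ((16 * d) ^ d / (r * c) * F) := by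
          rw [hq, hρ, div_pow, div_pow, mul_pow]
          field_simp
      _ ≤ 1 * ((16 * d) ^ d / (r * c) * F) := by
          gcongr
          exact pow_le_one₀ hδ0.le hδ1
      _ = _ := one_mul _

/-- The distance from a point outside `Ω` to `Ω` is attained on the frontier. Hence the collar
completes every `δ`-ball centred in `Ω`. -/
theorem mem_union_collar_of_dist_lt {Ω : Set (Space d)} {δ : ℝ} {x y : Space d} (hx : x ∈ Ω)
    (hxy : dist y x < δ) : y ∈ Ω ∪ collar Ω δ := by
  by_cases hy : y ∈ Ω
  · exact Or.inl hy
  refine Or.inr ⟨hy, ?_⟩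
  obtain ⟨z, hz, hzd⟩ := exists_mem_frontier_infDist_compl_eq_dist (s := Ωᶜ) (x := y) hy
    (fun h => by
      have : x ∈ Ωᶜ := h ▸ Set.mem_univ x
      exact this hx)
  rw [frontier_compl] at hz
  rw [compl_compl] at hzd
  calc Metric.infDist y (frontier Ω) ≤ dist y z := Metric.infDist_le_dist_of_mem hz
    _ = Metric.infDist y Ω := hzd.symm
    _ ≤ dist y x := Metric.infDist_le_dist_of_mem hx
    _ < δ := hxy

theorem neighbors_grid {Ω : Set (Space d)} {δ h : ℝ} {x : Space d} (hx : x ∈ Ω) :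
    neighbors (grid Ω δ h) δ x = neighbors (lattice d h) δ x := by
  ext y
  simp only [neighbors, grid, Set.mem_sdiff, Set.mem_inter_iff]
  constructor
  · rintro ⟨⟨⟨h1, -⟩, h2⟩, h3⟩
    exact ⟨⟨h1, h2⟩, h3⟩
  · rintro ⟨⟨h1, h2⟩, h3⟩
    exact ⟨⟨⟨h1, mem_union_collar_of_dist_lt hx h2⟩, h2⟩, h3⟩

theorem isQuadratureWeight_grid_iff {s : ℝ} {Ω : Set (Space d)} {δ h : ℝ} {x : Space d}
    (hx : x ∈ Ω) (w : Space d → ℝ) : IsQuadratureWeight s (grid Ω δ h) δ x w ↔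
      IsQuadratureWeight s (lattice d h) δ x w := by
  simp only [IsQuadratureWeight, IsExact, objective, neighbors_grid hx]

open Classical in
/-- The integer coordinates of the grid points in a bounded set. -/
theorem exists_gridIndices {Ω : Set (Space d)} {ρ : ℝ} (hρ : 0 < ρ)
    (hΩ : Ω ⊆ Metric.ball 0 ρ) {h : ℝ} (hh : 0 < h) (hh1 : h ≤ 1) :
    ∃ P : Finset (Fin d → ℤ), (∀ k, k ∈ P ↔ latticePoint h k ∈ Ω) ∧
      (P.card : ℝ) ≤ ((2 * ρ + 3) / h) ^ d := by
  refine ⟨(box d (⌈ρ / h⌉₊ : ℕ)).filter fun k => latticePoint h k ∈ Ω, fun k => ?_, ?_⟩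
  · rw [Finset.mem_filter, and_iff_right_iff_imp]
    intro hk
    exact mem_box_of_norm_lt hh (by simpa using hΩ hk) (by exact_mod_cast Nat.le_ceil (ρ / h))
  · calc _ ≤ ((box d (⌈ρ / h⌉₊ : ℕ)).card : ℝ) := by exact_mod_cast Finset.card_filter_le _ _
      _ = (2 * (⌈ρ / h⌉₊ : ℝ) + 1) ^ d := by
          rw [card_box]
          push_cast
          ring
      _ ≤ ((2 * ρ + 3) / h) ^ d := by
          have h1 : (⌈ρ / h⌉₊ : ℝ) < ρ / h + 1 := Nat.ceil_lt_add_one (by positivity)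
          have h2 : 1 ≤ 1 / h := (one_le_div hh).2 hh1
          have h3 : (2 * ρ + 3) / h = 2 * (ρ / h) + 3 * (1 / h) := by ring
          gcongr
          linarith

end MaximumBound

end NonlocalMeshfree

/-! ### The stability theorem -/

theorem mainTheorem8 (d : ℕ) (hd : 0 < d) (s : ℝ) (hs : 0 ≤ s) (hsd : s < d)
    (Ω : Set (NonlocalMeshfree.Space d)) (hΩ_open : IsOpen Ω) (hΩ_conn : IsConnected Ω)
    (hΩ_bdd : Bornology.IsBounded Ω)
    (r R : ℝ) (hr : 0 < r)
    (A : NonlocalMeshfree.Space d → NonlocalMeshfree.Space d → ℝ)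
    (ha : ContDiffOn ℝ ∞ (fun x => A x x) Ω) :
    ∃ C δ₀ : ℝ, 0 < C ∧ 0 < δ₀ ∧
      ∀ δ h : ℝ, 0 < δ → δ < δ₀ → 0 < h → h < NonlocalMeshfree.posConst d s * δ →
        NonlocalMeshfree.HasC1Boundary (Ω ∪ NonlocalMeshfree.collar Ω δ) →
        NonlocalMeshfree.IsAdmissible Ω δ r R A →
        ∀ w : NonlocalMeshfree.Space d → NonlocalMeshfree.Space d → ℝ,
          (∀ x ∈ NonlocalMeshfree.grid Ω δ h ∩ Ω,
            NonlocalMeshfree.IsQuadratureWeight s (NonlocalMeshfree.grid Ω δ h) δ x (w x)) →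
        ∀ f uD u : NonlocalMeshfree.Space d → ℝ,
          BddAbove ((fun x => |uD x|) '' NonlocalMeshfree.collar Ω δ) →
          NonlocalMeshfree.IsDiscreteSolution s Ω A δ h w f uD u →
          ∀ x ∈ NonlocalMeshfree.grid Ω δ h,
            |u x| ≤ sSup ((fun y => |uD y|) '' NonlocalMeshfree.collar Ω δ)
              + C * sSup ((fun y => |f y|) '' (NonlocalMeshfree.grid Ω δ h ∩ Ω)) := by
  open NonlocalMeshfree in
  have : NeZero d := ⟨hd.ne'⟩
  have hD := kernelConst_pos hsd
  obtain ⟨C₁, hC₁, hsum⟩ := exists_sum_jumps_inv_norm_rpow_le d hs hsd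
  obtain ⟨ρ, hρ, hΩρ⟩ : ∃ ρ, 0 < ρ ∧ Ω ⊆ Metric.ball 0 ρ := by
    obtain ⟨ρ, hρ⟩ := hΩ_bdd.subset_ball 0
    exact ⟨max ρ 1, by positivity, hρ.trans (Metric.ball_subset_ball (le_max_left _ _))⟩
  have hv : 0 < volume.real (Metric.ball (0 : Space d) 1) :=
    ENNReal.toReal_pos (Metric.measure_ball_pos _ _ one_pos).ne' measure_ball_lt_top.ne
  obtain ⟨κ, hκ, hbound⟩ := exists_bound_of_conductance (d := d) (s := s) (ℓ := 2 * ρ + 3)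
    hs hD hv hC₁ hr (by positivity)
  refine ⟨κ, 1, hκ, one_pos, ?_⟩
  intro δ h hδ0 hδ1 hh hhpos _ hadm w hw f uD u hbdd hsol
  set m := sSup ((fun y => |uD y|) '' collar Ω δ) with hm
  set M := sSup ((fun y => |f y|) '' (grid Ω δ h ∩ Ω)) with hM
  have hm0 : 0 ≤ m := Real.sSup_nonneg (by rintro _ ⟨y, -, rfl⟩; exact abs_nonneg _)
  have hM0 : 0 ≤ M := Real.sSup_nonneg (by rintro _ ⟨y, -, rfl⟩; exact abs_nonneg _)
  have hcollar : ∀ x ∈ grid Ω δ h ∩ collar Ω δ, |u x| ≤ m := fun x hx => by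
    rw [hsol.boundary x hx]
    exact le_csSup hbdd ⟨x, hx.2, rfl⟩
  -- The supremum of the empty set is `0`, so `0 < h < posConst d s * δ` forces an admissible
  -- constant to exist.
  obtain ⟨c, ⟨-, hc⟩, hcδ⟩ : ∃ c ∈ positivityConstants d s, h / δ < c := by
    have h1 : h / δ < posConst d s := (div_lt_iff₀ hδ0).2 hhpos
    refine exists_lt_of_lt_csSup ?_ h1
    by_contra hne
    rw [Set.not_nonempty_iff_eq_empty] at hne
    rw [posConst, hne, Real.sSup_empty] at h1
    exact absurd h1 (not_lt.2 (by positivity))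
  have hc := hc δ h hδ0 hh ((div_lt_iff₀ hδ0).1 hcδ)
  have hδ : 2 * h < δ := two_mul_lt_of_isUnisolvent hh (hc 0 ⟨0, fun i => by simp⟩).1
  obtain ⟨α, β, hmass, hweight⟩ := exists_eq_radialWeight (d := d) hs hsd hh hδ
  obtain ⟨P, hP, hPcard⟩ := exists_gridIndices hρ hΩρ hh (by linarith)
  have hgrid : ∀ k ∈ P, latticePoint h k ∈ grid Ω δ h ∩ Ω := fun k hk =>
    ⟨⟨mem_lattice_iff.2 ⟨k, rfl⟩, Or.inl ((hP k).1 hk)⟩, (hP k).1 hk⟩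
  have hwP : ∀ k ∈ P, IsQuadratureWeight s (lattice d h) δ (latticePoint h k)
      (w (latticePoint h k)) := fun k hk =>
    (isQuadratureWeight_grid_iff ((hP k).1 hk) _).1 (hw _ (hgrid k hk))
  have hfM : ∀ x ∈ grid Ω δ h ∩ Ω, |f x| ≤ M := by
    intro x hx
    refine le_csSup (Set.Finite.bddAbove ?_) ⟨x, hx, rfl⟩
    refine Set.Finite.image _ ((P.finite_toSet.image (latticePoint h)).subset ?_)
    rintro y ⟨⟨hy, -⟩, hyΩ⟩
    obtain ⟨k, rfl⟩ := mem_lattice_iff.1 hy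
    exact ⟨k, (hP k).2 hyΩ, rfl⟩
  -- Subtracting `m` makes the function nonpositive on the collar without changing differences; `σ =
  -- ±1` gives the two sides of the absolute value.
  have key : ∀ σ : ℝ, |σ| ≤ 1 → ∀ F, 0 < F → M ≤ F → ∀ k ∈ P,
      σ * u (latticePoint h k) - m ≤ κ * F := by
    intro σ hσ F hF hMF k₀ hk₀
    have hpos : ∀ k ∈ jumps d h δ, 0 < α + β * ‖latticePoint h k‖ ^ 2 := fun k hk => by
      have hx : latticePoint h k₀ ∈ lattice d h := mem_lattice_iff.2 ⟨k₀, rfl⟩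
      rw [← hweight _ hx _ (hwP k₀ hk₀) k hk]
      refine (hc _ hx).2 _ (hwP k₀ hk₀) _ ?_
      rw [neighbors_lattice hh hx]
      exact ⟨k, hk, rfl⟩
    refine hbound h δ α β hh hδ hδ1.le hpos (hsum h δ hh (by linarith))
      ((div_sq_le_integral_kernel hs hsd hδ0).trans hmass.ge) P
      {k | latticePoint h k ∈ Ω ∪ collar Ω δ} (fun k hk => Or.inl ((hP k).1 hk)) ?_ hPcard
      (fun i j => A (latticePoint h i) (latticePoint h j) *
        (kernel d s δ ‖latticePoint h (j - i)‖ * (α + β * ‖latticePoint h (j - i)‖ ^ 2)))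
      ?_ ?_ (fun k => σ * u (latticePoint h k) - m) F hF ?_ ?_ k₀ hk₀
    · intro x hx z hz
      refine mem_union_collar_of_dist_lt ((hP x).1 hx) ?_
      rw [latticePoint_add, dist_eq_norm, add_sub_cancel_left]
      exact ((mem_jumps hh).1 hz).2
    · intro x hx y hy
      rw [hadm.symm _ hx _ hy, ← neg_sub x y, latticePoint_neg, norm_neg]
    · intro x hx z hz hxz
      rw [add_sub_cancel_left]
      have hkz := div_pow_le_kernel (d := d) hs hD.le
        (norm_latticePoint_pos hh ((mem_jumps hh).1 hz).1) ((mem_jumps hh).1 hz).2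
      exact mul_le_mul_of_nonneg_right (hadm.bounds _ hx _ hxz).1
        (mul_nonneg (le_trans (by positivity) hkz) (hpos z hz).le)
    · intro x hx hxP
      have hxΩ : latticePoint h x ∉ Ω := fun h' => hxP ((hP x).2 h')
      have h1 := hcollar _ ⟨⟨mem_lattice_iff.2 ⟨x, rfl⟩, hx⟩, hx.resolve_left hxΩ⟩
      have h2 : σ * u (latticePoint h x) ≤ |σ| * |u (latticePoint h x)| := by
        rw [← abs_mul]
        exact le_abs_self _
      have h3 : |σ| * |u (latticePoint h x)| ≤ 1 * m := by gcongr
      linarith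
    · intro x hx
      have hxl : latticePoint h x ∈ lattice d h := mem_lattice_iff.2 ⟨x, rfl⟩
      have heq := hsol.equation _ (hgrid x hx)
      rw [discreteOperator, neighbors_grid ((hP x).1 hx), finsum_mem_neighbors_lattice hh hxl] at heq
      have e : ∑ z ∈ jumps d h δ, A (latticePoint h x) (latticePoint h (x + z)) *
          (kernel d s δ ‖latticePoint h (x + z - x)‖ *
            (α + β * ‖latticePoint h (x + z - x)‖ ^ 2)) *
          (σ * u (latticePoint h x) - m - (σ * u (latticePoint h (x + z)) - m)) =
          σ * f (latticePoint h x) / 2 := by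
        rw [← heq, mul_neg, neg_div, mul_left_comm, mul_div_cancel_left₀ _ two_ne_zero,
          Finset.mul_sum, ← Finset.sum_neg_distrib]
        refine Finset.sum_congr rfl fun z hz => ?_
        rw [hweight _ hxl _ (hwP x hx) z hz, latticePoint_add, add_sub_cancel_left,
          sub_add_cancel_left, norm_neg]
        ring
      refine e.le.trans ?_
      have h1 := hfM _ (hgrid x hx)
      have h2 : σ * f (latticePoint h x) ≤ |σ| * |f (latticePoint h x)| := by
        rw [← abs_mul]
        exact le_abs_self _
      have h3 : |σ| * |f (latticePoint h x)| ≤ 1 * M := by gcongr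
      linarith
  rintro x ⟨hxl, hx⟩
  rcases hx with hx | hx
  · obtain ⟨k, rfl⟩ := mem_lattice_iff.1 hxl
    -- The bound needs a strictly positive source bound, whereas `M` may vanish.
    refine le_of_forall_pos_le_add fun ε hε => ?_
    have hF : 0 < M + ε / κ := by positivity
    have hMF : M ≤ M + ε / κ := le_add_of_nonneg_right (by positivity)
    have h1 := key 1 (by simp) _ hF hMF k ((hP k).2 hx)
    have h2 := key (-1) (by simp) _ hF hMF k ((hP k).2 hx)
    have h3 : κ * (M + ε / κ) = κ * M + ε := by field_simp
    rw [abs_le]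
    constructor <;> linarith
  · have := hcollar x ⟨⟨hxl, Or.inr hx⟩, hx⟩
    have : 0 ≤ κ * M := by positivity
    linarith
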